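/- Let $(S,\mathfrak n)$ be a commutative noetherian local ring, let $\omega\in\mathfrak n$ be a non-zerodivisor, and put $R=S/(\omega)$. **The homotopy category.** Let $\mathsf{Mon}(\omega,\mathcal P)$ be the category whose objects are the monomorphisms $f:P\to Q$ between finitely generated projective $S$-modules with $\omega\operatorname{Coker}f=0$; a morphism $(P\xrightarrow{f}Q)\to(P'\xrightarrow{f'}Q')$ is a pair $\psi=(\psi_1,\psi_0)$ of $S$-linear maps $\psi_1:P\to P'$, $\psi_0:Q\to Q'$ with $\psi_0f=f'\psi_1$. It is null-homotopic if there are $S$-linear maps $s_1:P\to Q'$ and $s_0:Q\to P'$ with $f'\psi_1-f's_0f=\omega s_1$, and $\mathsf{HMon}(\omega,\mathcal P)$ is the quotient of $\mathsf{Mon}(\omega,\mathcal P)$ by the null-homotopic morphisms. For an object $f:P\to Q$ let $f_\Sigma:Q\to P$ be the unique map with $ff_\Sigma=\omega\cdot\mathrm{id}_Q$ and $f_\Sigma f=\omega\cdot\mathrm{id}_P$. The suspension is $\Sigma(P\xrightarrow{f}Q)=(Q\xrightarrow{-f_\Sigma}P)$, $\Sigma(\psi_1,\psi_0)=(\psi_0,\psi_1)$.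 The mapping cone of $\psi$ is $C(\psi)=\bigl(P'\oplus Q\xrightarrow{c}Q'\oplus P\bigr)$ with $c=\begin{pmatrix}f'&\psi_0\\0&-f_\Sigma\end{pmatrix}$, and the exact triangles are those isomorphic to a standard triangle $$(P\xrightarrow{f}Q)\xrightarrow{\ \psi\ }(P'\xrightarrow{f'}Q')\xrightarrow{[\mathrm{id}\ 0]^t}C(\psi)\xrightarrow{[0\ \mathrm{id}]}\Sigma(P\xrightarrow{f}Q).$$ **The stable category.** A finitely generated $R$-module is called Gorenstein projective if it is a syzygy of an acyclic complex of finitely generated projective $R$-modules that stays acyclic under $\operatorname{Hom}_R(-,L)$ for every projective $R$-module $L$; these modules form the category $\mathsf{Gp}(R)$. Its stable category $\underline{\mathsf{Gp}}(R)$ has the same objects, with morphisms taken modulo those that factor through a finitely generated projective module. For each $M\in\mathsf{Gp}(R)$ choose a short exact sequence $0\to M\to I(M)\to\Omega^{-1}M\to0$ in $\mathsf{Gp}(R)$ with $I(M)$ projective; this defines the suspension functor $\Omega^{-1}$ on $\underline{\mathsf{Gp}}(R)$. The exact triangles are those isomorphic to a standard triangle $M\xrightarrow{u}M'\xrightarrow{v}C\xrightarrow{w}\Omega^{-1}M$,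 where $u$ is a morphism of $\mathsf{Gp}(R)$, $C$ is the pushout of $M'\xleftarrow{u}M\to I(M)$, $v$ is the canonical map, and $w$ is the map which vanishes on $M'$ and restricts to the projection $I(M)\to\Omega^{-1}M$. **Statement.** Let $T:\mathsf{HMon}(\omega,\mathcal P)\to\underline{\mathsf{Gp}}(R)$ be the functor which sends $(P\xrightarrow{f}Q)$ to $\operatorname{Coker}f$ and the class of $(\psi_1,\psi_0)$ to the class of the induced map $\operatorname{Coker}f\to\operatorname{Coker}f'$. Then $T$ is a triangle functor: it is additive, and there is a natural isomorphism $\zeta:T\Sigma\cong\Omega^{-1}T$ (so that $\operatorname{Coker}(-f_\Sigma)\cong\Omega^{-1}(\operatorname{Coker}f)$ in $\underline{\mathsf{Gp}}(R)$ for every object $f$) such that for every exact triangle $X\xrightarrow{a}Y\xrightarrow{b}Z\xrightarrow{c}\Sigma X$ of $\mathsf{HMon}(\omega,\mathcal P)$ the triangle $TX\xrightarrow{Ta}TY\xrightarrow{Tb}TZ\xrightarrow{\zeta_X\circ Tc}\Omega^{-1}TX$ is exact in $\underline{\mathsf{Gp}}(R)$. -/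

import Mathlib

open CategoryTheory

universe u

/-! ### Categories with a suspension and a class of exact triangles -/

section Triangles

variable {C : Type*} [Category* C] {D : Type*} [Category* D]

/-- A triangle `X ⟶ Y ⟶ Z ⟶ ΣX` with respect to a suspension functor `Σ`. -/
structure SuspTriangle (susp : C ⥤ C) where
  X : C
  Y : C
  Z : C
  mor₁ : X ⟶ Y
  mor₂ : Y ⟶ Z
  mor₃ : Z ⟶ susp.obj X

/-- Two triangles are isomorphic if there are isomorphisms between their terms which make the
three squares commute, the isomorphism `ΣX ⟶ ΣX'` being the suspension of `X ⟶ X'`. -/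
def SuspTriangle.Isomorphic {susp : C ⥤ C} (t t' : SuspTriangle susp) : Prop :=
  ∃ (a : t.X ≅ t'.X) (b : t.Y ≅ t'.Y) (c : t.Z ≅ t'.Z),
    t.mor₁ ≫ b.hom = a.hom ≫ t'.mor₁ ∧
    t.mor₂ ≫ c.hom = b.hom ≫ t'.mor₂ ∧
    t.mor₃ ≫ susp.map a.hom = c.hom ≫ t'.mor₃

/-- The data of a triangulated structure: a suspension functor and a class of exact triangles. -/
structure TriangleData (C : Type*) [Category* C] where
  susp : C ⥤ C
  exact : Set (SuspTriangle susp)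

/-- The image of the triangle `X ⟶ Y ⟶ Z ⟶ ΣX` under a functor `F` and a natural isomorphism
`ζ : FΣ ≅ ΣF`, i.e. `FX ⟶ FY ⟶ FZ ⟶ FΣX ⟶ ΣFX`. -/
def SuspTriangle.map {susp : C ⥤ C} {susp' : D ⥤ D} (F : C ⥤ D)
    (ζ : susp ⋙ F ≅ F ⋙ susp') (t : SuspTriangle susp) : SuspTriangle susp' where
  X := F.obj t.X
  Y := F.obj t.Y
  Z := F.obj t.Z
  mor₁ := F.map t.mor₁
  mor₂ := F.map t.mor₂
  mor₃ := F.map t.mor₃ ≫ ζ.hom.app t.X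

/-- An additive functor `F` is a triangle functor if there is a natural isomorphism `FΣ ≅ ΣF`
with which `F` takes exact triangles to exact triangles. -/
def IsTriangleFunctor [Preadditive C] [Preadditive D] (𝒞 : TriangleData C) (𝒟 : TriangleData D)
    (F : C ⥤ D) : Prop :=
  F.Additive ∧ ∃ ζ : 𝒞.susp ⋙ F ≅ F ⋙ 𝒟.susp, ∀ t ∈ 𝒞.exact, t.map F ζ ∈ 𝒟.exact

end Triangles

/-! ### The category of monomorphisms between projectives with cokernel killed by `ω` -/

/-- A map out of a projective module lifts along any map whose range contains its values. -/
lemma exists_lift_of_mem_range {A : Type*} [CommRing A] {M N L : Type*} [AddCommGroup M]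
    [AddCommGroup N] [AddCommGroup L] [Module A M] [Module A N] [Module A L]
    [Module.Projective A L] (a : M →ₗ[A] N) (g : L →ₗ[A] N)
    (h : ∀ x, g x ∈ LinearMap.range a) : ∃ k : L →ₗ[A] M, ∀ x, a (k x) = g x := by
  obtain ⟨k, hk⟩ := Module.projective_lifting_property a.rangeRestrict (g.codRestrict _ h)
    a.surjective_rangeRestrict
  exact ⟨k, fun x => congrArg Subtype.val (LinearMap.congr_fun hk x)⟩

lemma eq_zero_of_smul_eq_zero {S : Type u} [CommRing S] {ω : S}
    (hω : ω ∈ nonZeroDivisors S) {M : Type*} [AddCommGroup M] [Module S M]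
    [Module.Projective S M] {x : M} (h : ω • x = 0) : x = 0 :=
  Module.Flat.isSMulRegular_of_nonZeroDivisors hω (by simpa using h)

/-- The objects of `Mon(ω, 𝒫)`: monomorphisms `f : P → Q` of finitely generated projective
`S`-modules such that `ω` annihilates the cokernel of `f`. -/
structure MonProj (S : Type u) [CommRing S] (ω : S) where
  P : ModuleCat.{u} S
  Q : ModuleCat.{u} S
  f : P →ₗ[S] Q
  [finite_P : Module.Finite S P]
  [finite_Q : Module.Finite S Q]
  [projective_P : Module.Projective S P]
  [projective_Q : Module.Projective S Q]
  injective : Function.Injective f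
  torsion : Module.IsTorsionBy S (Q ⧸ LinearMap.range f) ω

namespace MonProj

attribute [instance] finite_P finite_Q projective_P projective_Q

section

variable {S : Type u} [CommRing S] {ω : S}

/-- A morphism `(P → Q) ⟶ (P' → Q')`: a commutative square `(ψ₁, ψ₀)`. -/
@[ext]
structure Hom (X Y : MonProj S ω) where
  one : X.P →ₗ[S] Y.P
  zero : X.Q →ₗ[S] Y.Q
  comm : ∀ p, zero (X.f p) = Y.f (one p)

instance : Category (MonProj S ω) where
  Hom := Hom
  id X := ⟨LinearMap.id, LinearMap.id, fun _ => rfl⟩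
  comp φ ψ := ⟨ψ.one ∘ₗ φ.one, ψ.zero ∘ₗ φ.zero, fun p => by simp [φ.comm, ψ.comm]⟩

variable {X Y Z : MonProj S ω}

@[ext]
lemma hom_ext {φ ψ : X ⟶ Y} (h₁ : φ.one = ψ.one) (h₀ : φ.zero = ψ.zero) : φ = ψ :=
  Hom.ext h₁ h₀

@[simp] lemma hom_id_one (X : MonProj S ω) : Hom.one (𝟙 X) = LinearMap.id := rfl
@[simp] lemma hom_id_zero (X : MonProj S ω) : Hom.zero (𝟙 X) = LinearMap.id := rfl
@[simp] lemma hom_comp_one (φ : X ⟶ Y) (ψ : Y ⟶ Z) : (φ ≫ ψ).one = ψ.one ∘ₗ φ.one := rfl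
@[simp] lemma hom_comp_zero (φ : X ⟶ Y) (ψ : Y ⟶ Z) : (φ ≫ ψ).zero = ψ.zero ∘ₗ φ.zero := rfl

instance : Zero (X ⟶ Y) := ⟨⟨0, 0, fun _ => by simp⟩⟩
instance : Add (X ⟶ Y) :=
  ⟨fun φ ψ => ⟨φ.one + ψ.one, φ.zero + ψ.zero, fun p => by simp [φ.comm, ψ.comm]⟩⟩
instance : Neg (X ⟶ Y) := ⟨fun φ => ⟨-φ.one, -φ.zero, fun p => by simp [φ.comm]⟩⟩
instance : Sub (X ⟶ Y) :=
  ⟨fun φ ψ => ⟨φ.one - ψ.one, φ.zero - ψ.zero, fun p => by simp [φ.comm, ψ.comm]⟩⟩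

@[simp] lemma hom_zero_one : Hom.one (0 : X ⟶ Y) = 0 := rfl
@[simp] lemma hom_zero_zero : Hom.zero (0 : X ⟶ Y) = 0 := rfl
@[simp] lemma hom_add_one (φ ψ : X ⟶ Y) : (φ + ψ).one = φ.one + ψ.one := rfl
@[simp] lemma hom_add_zero (φ ψ : X ⟶ Y) : (φ + ψ).zero = φ.zero + ψ.zero := rfl
@[simp] lemma hom_neg_one (φ : X ⟶ Y) : (-φ).one = -φ.one := rfl
@[simp] lemma hom_neg_zero (φ : X ⟶ Y) : (-φ).zero = -φ.zero := rfl
@[simp] lemma hom_sub_one (φ ψ : X ⟶ Y) : (φ - ψ).one = φ.one - ψ.one := rfl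
@[simp] lemma hom_sub_zero (φ ψ : X ⟶ Y) : (φ - ψ).zero = φ.zero - ψ.zero := rfl

instance : AddCommGroup (X ⟶ Y) where
  add_assoc _ _ _ := by ext <;> simp [add_assoc]
  zero_add _ := by ext <;> simp
  add_zero _ := by ext <;> simp
  add_comm _ _ := by ext <;> simp [add_comm]
  neg_add_cancel _ := by ext <;> simp
  sub_eq_add_neg _ _ := by ext <;> simp [sub_eq_add_neg]
  nsmul := nsmulRec
  zsmul := zsmulRec

instance : Preadditive (MonProj S ω) where
  add_comp _ _ _ _ _ _ := by ext <;> simp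
  comp_add _ _ _ _ _ _ := by ext <;> simp

/-- A morphism `ψ = (ψ₁, ψ₀)` is null-homotopic if there are `s₁ : P → Q'` and `s₀ : Q → P'`
with `f' ψ₁ - f' s₀ f = ω s₁`. -/
def NullHomotopic (ψ : X ⟶ Y) : Prop :=
  ∃ (s₁ : X.P →ₗ[S] Y.Q) (s₀ : X.Q →ₗ[S] Y.P),
    ∀ p, Y.f (ψ.one p) - Y.f (s₀ (X.f p)) = ω • s₁ p

lemma nullHomotopic_zero : NullHomotopic (0 : X ⟶ Y) := ⟨0, 0, fun _ => by simp⟩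

lemma NullHomotopic.add {φ ψ : X ⟶ Y} (hφ : NullHomotopic φ) (hψ : NullHomotopic ψ) :
    NullHomotopic (φ + ψ) := by
  obtain ⟨s, t, h⟩ := hφ
  obtain ⟨s', t', h'⟩ := hψ
  refine ⟨s + s', t + t', fun p => ?_⟩
  simp only [hom_add_one, LinearMap.add_apply, map_add, smul_add, ← h, ← h']
  abel

lemma NullHomotopic.neg {φ : X ⟶ Y} (hφ : NullHomotopic φ) : NullHomotopic (-φ) := by
  obtain ⟨s, t, h⟩ := hφ
  refine ⟨-s, -t, fun p => ?_⟩
  simp only [hom_neg_one, LinearMap.neg_apply, map_neg, smul_neg, ← h]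
  abel

lemma NullHomotopic.comp_left {ψ : Y ⟶ Z} (hψ : NullHomotopic ψ) (φ : X ⟶ Y) :
    NullHomotopic (φ ≫ ψ) := by
  obtain ⟨s, t, h⟩ := hψ
  exact ⟨s ∘ₗ φ.one, t ∘ₗ φ.zero, fun p => by simp [← h, φ.comm]⟩

lemma NullHomotopic.comp_right {φ : X ⟶ Y} (hφ : NullHomotopic φ) (ψ : Y ⟶ Z) :
    NullHomotopic (φ ≫ ψ) := by
  obtain ⟨s, t, h⟩ := hφ
  refine ⟨ψ.zero ∘ₗ s, ψ.one ∘ₗ t, fun p => ?_⟩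
  simp only [hom_comp_one, LinearMap.comp_apply, ← map_smul, ← h, map_sub, ψ.comm]

variable (S ω) in
/-- Two morphisms are homotopic if their difference is null-homotopic. -/
def homotopic : HomRel (MonProj S ω) := fun _ _ φ ψ => NullHomotopic (φ - ψ)

instance : Congruence (homotopic S ω) where
  equivalence :=
    { refl := fun φ => by simpa [homotopic] using nullHomotopic_zero
      symm := fun h => by simpa [homotopic] using h.neg
      trans := fun h h' => by simpa [homotopic] using h.add h' }
  comp_left φ _ _ h := by
    simpa [homotopic, ← Preadditive.comp_sub] using NullHomotopic.comp_left h φ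
  comp_right ψ h := by
    simpa [homotopic, ← Preadditive.sub_comp] using NullHomotopic.comp_right h ψ

end

end MonProj

/-- The homotopy category `HMon(ω, 𝒫)`: morphisms of `Mon(ω, 𝒫)` modulo null-homotopic ones. -/
abbrev HMon (S : Type u) [CommRing S] (ω : S) := CategoryTheory.Quotient (MonProj.homotopic S ω)

instance (S : Type u) [CommRing S] (ω : S) : Preadditive (HMon S ω) :=
  CategoryTheory.Quotient.preadditive _ fun _ _ _ _ _ _ h h' => by
    simpa [MonProj.homotopic, add_sub_add_comm] using MonProj.NullHomotopic.add h h'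

/-! ### Suspension, mapping cones and exact triangles in the homotopy category -/

namespace MonProj

variable {S : Type u} [CommRing S] {ω : S}

lemma smul_mem_range (X : MonProj S ω) (q : X.Q) : ω • q ∈ LinearMap.range X.f := by
  have := @X.torsion (Submodule.Quotient.mk q)
  rwa [← Submodule.Quotient.mk_smul, Submodule.Quotient.mk_eq_zero] at this

lemma isTorsionBy_of_smul_mem {M : Type*} [AddCommGroup M] [Module S M] {N : Submodule S M}
    (h : ∀ q : M, ω • q ∈ N) : Module.IsTorsionBy S (M ⧸ N) ω := by
  intro x
  obtain ⟨q, rfl⟩ := Submodule.Quotient.mk_surjective _ x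
  rw [← Submodule.Quotient.mk_smul, Submodule.Quotient.mk_eq_zero]
  exact h q

/-- The unique map `f_Σ : Q → P` with `f f_Σ = ω` and `f_Σ f = ω`. -/
noncomputable def fSigma (X : MonProj S ω) : X.Q →ₗ[S] X.P :=
  (exists_lift_of_mem_range X.f (ω • LinearMap.id) X.smul_mem_range).choose

@[simp]
lemma f_fSigma (X : MonProj S ω) (q : X.Q) : X.f (X.fSigma q) = ω • q :=
  (exists_lift_of_mem_range X.f (ω • LinearMap.id) X.smul_mem_range).choose_spec q

@[simp]
lemma fSigma_f (X : MonProj S ω) (p : X.P) : X.fSigma (X.f p) = ω • p :=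
  X.injective (by simp)

lemma fSigma_comm {X Y : MonProj S ω} (ψ : X ⟶ Y) (q : X.Q) :
    ψ.one (X.fSigma q) = Y.fSigma (ψ.zero q) :=
  Y.injective (by simp [← ψ.comm])

lemma fSigma_injective (hω : ω ∈ nonZeroDivisors S) (X : MonProj S ω) :
    Function.Injective X.fSigma := by
  rw [injective_iff_map_eq_zero]
  intro q hq
  exact eq_zero_of_smul_eq_zero hω (by rw [← X.f_fSigma, hq, map_zero])

/-- The suspension on `Mon(ω, 𝒫)`: it takes `(f : P → Q)` to `(-f_Σ : Q → P)` and `(ψ₁, ψ₀)` to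
`(ψ₀, ψ₁)`. -/
noncomputable def susp (hω : ω ∈ nonZeroDivisors S) : MonProj S ω ⥤ MonProj S ω where
  obj X :=
    { P := X.Q
      Q := X.P
      f := -X.fSigma
      injective := neg_injective.comp (X.fSigma_injective hω)
      torsion := isTorsionBy_of_smul_mem fun p => ⟨-X.f p, by simp⟩ }
  map ψ := ⟨ψ.zero, ψ.one, fun q => by simp [fSigma_comm]⟩

lemma NullHomotopic.susp (hω : ω ∈ nonZeroDivisors S) {X Y : MonProj S ω} {ψ : X ⟶ Y}
    (h : NullHomotopic ψ) : NullHomotopic ((susp hω).map ψ) := by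
  obtain ⟨s₁, s₀, h⟩ := h
  have key (q : X.Q) :
      (-Y.fSigma) (ψ.zero q) - (-Y.fSigma) ((-s₁) ((-X.fSigma) q)) = ω • (-s₀) q := by
    apply Y.injective
    have := h (X.fSigma q)
    rw [← ψ.comm, f_fSigma, map_smul, map_smul, map_smul] at this
    simp only [LinearMap.neg_apply, map_neg, map_sub, map_smul, f_fSigma, neg_neg, smul_neg]
    rw [← sub_eq_zero] at this ⊢
    rw [← neg_eq_zero, ← this]
    abel
  exact ⟨-s₀, -s₁, key⟩

/-- The mapping cone of `ψ : (P → Q) ⟶ (P' → Q')` is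
`[f' ψ₀; 0 -f_Σ] : P' ⊕ Q → Q' ⊕ P`. -/
noncomputable def cone (hω : ω ∈ nonZeroDivisors S) {X Y : MonProj S ω} (ψ : X ⟶ Y) :
    MonProj S ω where
  P := ModuleCat.of S (Y.P × X.Q)
  Q := ModuleCat.of S (Y.Q × X.P)
  f := (Y.f.coprod ψ.zero).prod ((-X.fSigma) ∘ₗ LinearMap.snd S Y.P X.Q)
  finite_P := inferInstanceAs (Module.Finite S (Y.P × X.Q))
  finite_Q := inferInstanceAs (Module.Finite S (Y.Q × X.P))
  projective_P := inferInstanceAs (Module.Projective S (Y.P × X.Q))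
  projective_Q := inferInstanceAs (Module.Projective S (Y.Q × X.P))
  injective := by
    rw [injective_iff_map_eq_zero]
    rintro ⟨p, q⟩ h
    have h₁ : Y.f p + ψ.zero q = 0 := congrArg Prod.fst h
    have h₂ : -X.fSigma q = 0 := congrArg Prod.snd h
    obtain rfl : q = 0 := X.fSigma_injective hω (by simpa using h₂)
    obtain rfl : p = 0 := Y.injective (by simpa using h₁)
    rfl
  torsion := isTorsionBy_of_smul_mem fun ⟨q, p⟩ =>
    ⟨(Y.fSigma q + ψ.one p, -X.f p), by
      refine Prod.ext ?_ ?_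
      · simp [ψ.comm]
      · simp⟩

/-- The inclusion `[id 0]ᵗ` of the target into the mapping cone. -/
noncomputable def coneInl (hω : ω ∈ nonZeroDivisors S) {X Y : MonProj S ω} (ψ : X ⟶ Y) :
    Y ⟶ cone hω ψ where
  one := LinearMap.inl S Y.P X.Q
  zero := LinearMap.inl S Y.Q X.P
  comm p := by
    change ((Y.f p, 0) : Y.Q × X.P) = (Y.f p + ψ.zero 0, -X.fSigma 0)
    simp

/-- The projection `[0 id]` of the mapping cone onto the suspension of the source. -/
noncomputable def coneSnd (hω : ω ∈ nonZeroDivisors S) {X Y : MonProj S ω} (ψ : X ⟶ Y) :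
    cone hω ψ ⟶ (susp hω).obj X where
  one := LinearMap.snd S Y.P X.Q
  zero := LinearMap.snd S Y.Q X.P
  comm _ := rfl

end MonProj

namespace HMon

variable {S : Type u} [CommRing S] {ω : S}

/-- The suspension functor of the homotopy category. -/
noncomputable def susp (hω : ω ∈ nonZeroDivisors S) : HMon S ω ⥤ HMon S ω :=
  CategoryTheory.Quotient.lift _ (MonProj.susp hω ⋙ CategoryTheory.Quotient.functor _) fun _ _ _ _ h =>
    (CategoryTheory.Quotient.functor_map_eq_iff _ _ _).2 (MonProj.NullHomotopic.susp hω h)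

/-- The standard triangle `X ⟶ Y ⟶ C(ψ) ⟶ ΣX` of a morphism `ψ : X ⟶ Y`. -/
noncomputable def standardTriangle (hω : ω ∈ nonZeroDivisors S) {X Y : MonProj S ω}
    (ψ : X ⟶ Y) : SuspTriangle (susp hω) where
  X := (CategoryTheory.Quotient.functor _).obj X
  Y := (CategoryTheory.Quotient.functor _).obj Y
  Z := (CategoryTheory.Quotient.functor _).obj (MonProj.cone hω ψ)
  mor₁ := (CategoryTheory.Quotient.functor _).map ψ
  mor₂ := (CategoryTheory.Quotient.functor _).map (MonProj.coneInl hω ψ)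
  mor₃ := (CategoryTheory.Quotient.functor _).map (MonProj.coneSnd hω ψ)

/-- The suspension of the homotopy category, with the triangles isomorphic to a standard one. -/
noncomputable def triangleData (hω : ω ∈ nonZeroDivisors S) : TriangleData (HMon S ω) where
  susp := susp hω
  exact := {t | ∃ (X Y : MonProj S ω) (ψ : X ⟶ Y), t.Isomorphic (standardTriangle hω ψ)}

end HMon

/-! ### Gorenstein projective modules -/

/-- A totally acyclic complex of finitely generated projective modules (written with increasing
indices): an acyclic complex which stays exact under `Hom(-, L)` for every projective module `L`. -/
structure TotallyAcyclicComplex (R : Type u) [CommRing R] where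
  X : ℤ → ModuleCat.{u} R
  d : ∀ n, X n →ₗ[R] X (n + 1)
  finite : ∀ n, Module.Finite R (X n)
  projective : ∀ n, Module.Projective R (X n)
  exact : ∀ n, Function.Exact (d n) (d (n + 1))
  hom_exact : ∀ (L : ModuleCat.{u} R), Module.Projective R L → ∀ n,
    Function.Exact (LinearMap.lcomp R L (d (n + 1))) (LinearMap.lcomp R L (d n))

/-- Finitely generated Gorenstein projective modules: the syzygies of totally acyclic complexes. -/
def gorensteinProjective (R : Type u) [CommRing R] : ObjectProperty (ModuleCat.{u} R) :=
  fun M => Module.Finite R M ∧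
    ∃ (K : TotallyAcyclicComplex R) (n : ℤ), Nonempty (M ≃ₗ[R] LinearMap.ker (K.d n))

/-- The category `Gp(R)` of finitely generated Gorenstein projective `R`-modules. -/
abbrev Gp (R : Type u) [CommRing R] := (gorensteinProjective R).FullSubcategory

section Gorenstein

variable {R : Type u} [CommRing R]

/-- The 2-periodic complex `⋯ → A → B → A → B → ⋯` is totally acyclic, so that the kernel of
`A → B` is Gorenstein projective. -/
lemma gorensteinProjective_of_periodic {A B M : ModuleCat.{u} R} [Module.Finite R A]
    [Module.Finite R B] [Module.Projective R A] [Module.Projective R B] [Module.Finite R M]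
    (a : A →ₗ[R] B) (b : B →ₗ[R] A) (hab : Function.Exact a b) (hba : Function.Exact b a)
    (ha : ∀ (L : ModuleCat.{u} R), Module.Projective R L → ∀ g : B →ₗ[R] L, g ∘ₗ a = 0 →
      ∃ h : A →ₗ[R] L, h ∘ₗ b = g)
    (hb : ∀ (L : ModuleCat.{u} R), Module.Projective R L → ∀ g : A →ₗ[R] L, g ∘ₗ b = 0 →
      ∃ h : B →ₗ[R] L, h ∘ₗ a = g)
    (i : M →ₗ[R] A) (hi : Function.Injective i) (hM : Function.Exact i a) :
    gorensteinProjective R M := by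
  refine ⟨inferInstance, ?_⟩
  let T : Bool → ModuleCat.{u} R := fun x => if x then A else B
  let δ : ∀ x y : Bool, T x →ₗ[R] T y := fun x y => match x, y with
    | true, false => a
    | false, true => b
    | true, true => 0
    | false, false => 0
  let par : ℤ → Bool := fun n => decide (Even n)
  have hpar : ∀ n, par (n + 1) = !par n := fun n => by
    simp only [par, Int.even_add_one, decide_not]
  let K : TotallyAcyclicComplex R :=
    { X := fun n => T (par n)
      d := fun n => δ (par n) (par (n + 1))
      finite := fun n => by
        generalize par n = x
        cases x
        exacts [inferInstanceAs (Module.Finite R B), inferInstanceAs (Module.Finite R A)]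
      projective := fun n => by
        generalize par n = x
        cases x
        exacts [inferInstanceAs (Module.Projective R B), inferInstanceAs (Module.Projective R A)]
      exact := fun n => by
        have h₁ := hpar n
        have h₂ := hpar (n + 1)
        generalize par (n + 1 + 1) = z at *
        generalize par (n + 1) = y at *
        generalize par n = x at *
        subst h₁ h₂
        cases x
        exacts [hba, hab]
      hom_exact := fun L hL n => by
        have h₁ := hpar n
        have h₂ := hpar (n + 1)
        generalize par (n + 1 + 1) = z at *
        generalize par (n + 1) = y at *
        generalize par n = x at *
        subst h₁ h₂
        cases x
        · intro g
          refine ⟨hb L hL g, ?_⟩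
          rintro ⟨h, rfl⟩
          ext x
          exact (congrArg h (hba.apply_apply_eq_zero x)).trans (map_zero h)
        · intro g
          refine ⟨ha L hL g, ?_⟩
          rintro ⟨h, rfl⟩
          ext x
          exact (congrArg h (hab.apply_apply_eq_zero x)).trans (map_zero h) }
  have e : M ≃ₗ[R] LinearMap.ker a :=
    (LinearEquiv.ofInjective i hi).trans (LinearEquiv.ofEq _ _ hM.linearMap_ker_eq.symm)
  refine ⟨K, 0, ⟨?_⟩⟩
  exact e

/-- Finitely generated projective modules are Gorenstein projective. -/
lemma gorensteinProjective_of_projective (L : ModuleCat.{u} R) [Module.Finite R L]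
    [Module.Projective R L] : gorensteinProjective R L :=
  gorensteinProjective_of_periodic (A := L) (B := L) 0 LinearMap.id
    (fun x => by simp [eq_comm]) (fun x => by simp)
    (fun _ _ g _ => ⟨g, by simp⟩) (fun _ _ g hg => ⟨0, by simpa using hg.symm⟩)
    LinearMap.id Function.injective_id (fun x => by simp)

/-- A map from a submodule of `I` to a projective module extends to `I` if the quotient is
Gorenstein projective. -/
lemma exists_extension {M I N L : ModuleCat.{u} R} (hN : gorensteinProjective R N)
    [hL : Module.Projective R L] (i : M →ₗ[R] I) (p : I →ₗ[R] N) (hi : Function.Injective i)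
    (hip : Function.Exact i p) (hp : Function.Surjective p) (α : M →ₗ[R] L) :
    ∃ β : I →ₗ[R] L, β ∘ₗ i = α := by
  obtain ⟨-, K, n, ⟨e⟩⟩ := hN
  obtain ⟨k, rfl⟩ : ∃ k, n = k + 1 + 1 := ⟨n - 2, by ring⟩
  have := K.projective
  -- the surjection `q` from the projective module `K.X (k + 1)` onto `N`
  let q : K.X (k + 1) →ₗ[R] N := e.symm.toLinearMap ∘ₗ
    (K.d (k + 1)).codRestrict _ fun x => (K.exact (k + 1)).apply_apply_eq_zero x
  have hq : ∀ x, q x = 0 ↔ K.d (k + 1) x = 0 := fun x => by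
    refine e.symm.map_eq_zero_iff.trans ?_
    rw [Subtype.ext_iff]
    rfl
  have hqs : Function.Surjective q := by
    intro y
    obtain ⟨x, hx⟩ := ((K.exact (k + 1)) (e y).1).1 (e y).2
    refine ⟨x, e.symm_apply_eq.2 (Subtype.ext hx)⟩
  obtain ⟨r, hr⟩ := Module.projective_lifting_property p q hp
  replace hr : ∀ x, p (r x) = q x := fun x => LinearMap.congr_fun hr x
  obtain ⟨s, hs⟩ := exists_lift_of_mem_range i (r ∘ₗ K.d k) fun x => by
    rw [← hip.linearMap_ker_eq, LinearMap.mem_ker, LinearMap.comp_apply, hr, hq]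
    exact (K.exact k).apply_apply_eq_zero x
  -- extend `α s` from `K.X k` to `K.X (k + 1)`
  obtain ⟨k', rfl⟩ : ∃ k', k = k' + 1 := ⟨k - 1, by ring⟩
  obtain ⟨t, ht⟩ := ((K.hom_exact L hL k') (α ∘ₗ s)).1 (by
    ext x
    have : s (K.d k' x) = 0 := hi (by
      rw [hs, LinearMap.comp_apply, (K.exact k').apply_apply_eq_zero, map_zero, map_zero])
    simp [this])
  replace ht : ∀ x, t (K.d (k' + 1) x) = α (s x) := fun x => LinearMap.congr_fun ht x
  -- glue `α` and `t` along the surjection `M × K.X (k + 1) → I`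
  let σ : (M × K.X (k' + 1 + 1)) →ₗ[R] I := i.coprod r
  have hσ : Function.Surjective σ := by
    intro y
    obtain ⟨x, hx⟩ := hqs (p y)
    obtain ⟨m, hm⟩ := (hip (y - r x)).1 (by simp [hr, hx])
    exact ⟨(m, x), by simp [σ, hm]⟩
  have hker : LinearMap.ker σ ≤ LinearMap.ker (α.coprod t) := by
    rintro ⟨m, x⟩ hmx
    have h₀ : i m + r x = 0 := hmx
    have h₁ : K.d (k' + 1 + 1) x = 0 := by
      rw [← hq, ← hr]
      have := congrArg p h₀
      simpa [hip.apply_apply_eq_zero] using this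
    obtain ⟨z, rfl⟩ := ((K.exact (k' + 1)) x).1 h₁
    have h₂ : m + s z = 0 := hi (by
      rw [map_add, hs, map_zero]
      exact h₀)
    change α m + t (K.d (k' + 1) z) = 0
    rw [ht, ← map_add, h₂, map_zero]
  let Φ := (LinearMap.ker σ).liftQ (α.coprod t) hker
  refine ⟨Φ ∘ₗ (σ.quotKerEquivOfSurjective hσ).symm.toLinearMap, ?_⟩
  ext m
  have : (σ.quotKerEquivOfSurjective hσ).symm (i m) = Submodule.Quotient.mk (m, 0) := by
    rw [LinearEquiv.symm_apply_eq]
    simp [σ]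
  simp [this, Φ]

/-! ### The stable category of Gorenstein projective modules -/

namespace Gp

variable {M N L : Gp R}

/-- A morphism is stably zero if it factors through a finitely generated projective module. -/
def StablyZero (φ : M ⟶ N) : Prop :=
  ∃ (L : ModuleCat.{u} R) (_ : Module.Finite R L) (_ : Module.Projective R L)
    (α : M.obj ⟶ L) (β : L ⟶ N.obj), φ.hom = α ≫ β

lemma stablyZero_zero : StablyZero (0 : M ⟶ N) :=
  ⟨ModuleCat.of R PUnit.{u + 1}, inferInstanceAs (Module.Finite R PUnit.{u + 1}),
    inferInstanceAs (Module.Projective R PUnit.{u + 1}), 0, 0, by simp⟩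

lemma StablyZero.add {φ ψ : M ⟶ N} (hφ : StablyZero φ) (hψ : StablyZero ψ) :
    StablyZero (φ + ψ) := by
  obtain ⟨L, _, _, α, β, h⟩ := hφ
  obtain ⟨L', _, _, α', β', h'⟩ := hψ
  refine ⟨ModuleCat.of R (L × L'), inferInstanceAs (Module.Finite R (L × L')),
    inferInstanceAs (Module.Projective R (L × L')), ModuleCat.ofHom (α.hom.prod α'.hom),
    ModuleCat.ofHom (β.hom.coprod β'.hom), ?_⟩
  change φ.hom + ψ.hom = _
  rw [h, h']
  ext x
  simp

lemma StablyZero.neg {φ : M ⟶ N} (hφ : StablyZero φ) : StablyZero (-φ) := by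
  obtain ⟨L, h₁, h₂, α, β, h⟩ := hφ
  refine ⟨L, h₁, h₂, -α, β, ?_⟩
  change -φ.hom = _
  rw [h, Preadditive.neg_comp]

lemma StablyZero.comp_left {ψ : N ⟶ L} (hψ : StablyZero ψ) (φ : M ⟶ N) :
    StablyZero (φ ≫ ψ) := by
  obtain ⟨K, h₁, h₂, α, β, h⟩ := hψ
  exact ⟨K, h₁, h₂, φ.hom ≫ α, β, by simp [h]⟩

lemma StablyZero.comp_right {φ : M ⟶ N} (hφ : StablyZero φ) (ψ : N ⟶ L) :
    StablyZero (φ ≫ ψ) := by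
  obtain ⟨K, h₁, h₂, α, β, h⟩ := hφ
  exact ⟨K, h₁, h₂, α, β ≫ ψ.hom, by simp [h]⟩

variable (R) in
/-- Two morphisms are stably equal if their difference factors through a finitely generated
projective module. -/
def stablyEqual : HomRel (Gp R) := fun _ _ φ ψ => StablyZero (φ - ψ)

instance : Congruence (stablyEqual R) where
  equivalence :=
    { refl := fun φ => by simpa [stablyEqual] using stablyZero_zero
      symm := fun h => by simpa [stablyEqual] using h.neg
      trans := fun h h' => by simpa [stablyEqual] using h.add h' }
  comp_left φ _ _ h := by
    simpa [stablyEqual, ← Preadditive.comp_sub] using StablyZero.comp_left h φ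
  comp_right ψ h := by
    simpa [stablyEqual, ← Preadditive.sub_comp] using StablyZero.comp_right h ψ

end Gp

end Gorenstein

/-- The stable category of finitely generated Gorenstein projective `R`-modules. -/
abbrev StableGp (R : Type u) [CommRing R] := CategoryTheory.Quotient (Gp.stablyEqual R)

instance (R : Type u) [CommRing R] : Preadditive (StableGp R) :=
  CategoryTheory.Quotient.preadditive _ fun _ _ _ _ _ _ h h' => by
    simpa [Gp.stablyEqual, add_sub_add_comm] using Gp.StablyZero.add h h'

namespace Gp

variable {R : Type u} [CommRing R]

/-- A short exact sequence `0 → M → I → N → 0` in `Gp(R)` with `I` projective, so that `N` is a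
cosyzygy of `M`. -/
structure Cosyzygy (M : Gp R) where
  I : Gp R
  N : Gp R
  i : M ⟶ I
  p : I ⟶ N
  projective : Module.Projective R I.obj
  injective : Function.Injective i.hom
  exact : Function.Exact i.hom p.hom
  surjective : Function.Surjective p.hom

lemma nonempty_cosyzygy (M : Gp R) : Nonempty (Cosyzygy M) := by
  obtain ⟨M, hM, K, n, ⟨e⟩⟩ := M
  have := K.finite
  have := K.projective
  let N : ModuleCat.{u} R := ModuleCat.of R (LinearMap.range (K.d n))
  have hN : gorensteinProjective R N :=
    ⟨inferInstanceAs (Module.Finite R (LinearMap.range (K.d n))), K, n + 1,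
      ⟨LinearEquiv.ofEq _ _ (K.exact n).linearMap_ker_eq.symm⟩⟩
  exact ⟨{
    I := ⟨K.X n, gorensteinProjective_of_projective _⟩
    N := ⟨N, hN⟩
    i := ObjectProperty.homMk (ModuleCat.ofHom ((LinearMap.ker (K.d n)).subtype ∘ₗ e.toLinearMap))
    p := ObjectProperty.homMk (ModuleCat.ofHom (K.d n).rangeRestrict)
    projective := K.projective n
    injective := Subtype.val_injective.comp e.injective
    exact := fun x => by
      change (K.d n).rangeRestrict x = 0 ↔ ∃ y, (e y).1 = x
      rw [← Subtype.val_inj]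
      change K.d n x = 0 ↔ _
      exact ⟨fun h => ⟨e.symm ⟨x, h⟩, by simp⟩, by rintro ⟨y, rfl⟩; exact (e y).2⟩
    surjective := (K.d n).surjective_rangeRestrict }⟩

/-- A chosen short exact sequence `0 → M → I(M) → Ω⁻¹M → 0`. -/
noncomputable def cosyzygy (M : Gp R) : Cosyzygy M := (nonempty_cosyzygy M).some

/-- `v : Ω⁻¹M ⟶ Ω⁻¹M'` is induced by `u : M ⟶ M'` if the two are parts of a morphism of short
exact sequences from `0 → M → I(M) → Ω⁻¹M → 0` to `0 → M' → I(M') → Ω⁻¹M' → 0`. -/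
def Induced {M M' : Gp R} (u : M ⟶ M') (v : M.cosyzygy.N ⟶ M'.cosyzygy.N) : Prop :=
  ∃ w : M.cosyzygy.I ⟶ M'.cosyzygy.I,
    M.cosyzygy.i ≫ w = u ≫ M'.cosyzygy.i ∧ M.cosyzygy.p ≫ v = w ≫ M'.cosyzygy.p

/-- A morphism out of `I(M)` which vanishes on `M` factors through `Ω⁻¹M`. -/
lemma Cosyzygy.exists_desc {M L : Gp R} (c : Cosyzygy M) (w : c.I ⟶ L) (h : c.i ≫ w = 0) :
    ∃ v : c.N ⟶ L, c.p ≫ v = w := by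
  have h' : ∀ m, w.hom (c.i.hom m) = 0 := fun m =>
    congrArg (fun g : M ⟶ L => g.hom m) h
  let v := (c.exact.linearEquivOfSurjective c.surjective).symm.toLinearMap
  have hle : LinearMap.range c.i.hom.hom ≤ LinearMap.ker w.hom.hom := by
    rintro _ ⟨m, rfl⟩
    exact h' m
  refine ⟨ObjectProperty.homMk (ModuleCat.ofHom
    ((LinearMap.range c.i.hom.hom).liftQ w.hom.hom hle ∘ₗ v)), ?_⟩
  ext x
  have : v (c.p.hom x) = Submodule.Quotient.mk x := by
    simp only [v]
    refine (LinearEquiv.symm_apply_eq _).2 ?_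
    rfl
  change (LinearMap.range c.i.hom.hom).liftQ w.hom.hom hle (v (c.p.hom x)) = _
  rw [this]
  rfl

/-- A morphism from `M` to a projective object extends to `I(M)`. -/
lemma Cosyzygy.exists_extend {M : Gp R} (c : Cosyzygy M) {L : ModuleCat.{u} R}
    [Module.Projective R L] (α : M.obj ⟶ L) : ∃ β : c.I.obj ⟶ L, c.i.hom ≫ β = α := by
  obtain ⟨β, hβ⟩ := exists_extension c.N.property c.i.hom.hom c.p.hom.hom c.injective c.exact
    c.surjective α.hom
  exact ⟨ModuleCat.ofHom β, ModuleCat.hom_ext hβ⟩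

lemma exists_induced {M M' : Gp R} (u : M ⟶ M') : ∃ v, Induced u v := by
  have := M'.cosyzygy.projective
  obtain ⟨w, hw⟩ := M.cosyzygy.exists_extend (u ≫ M'.cosyzygy.i).hom
  have hw' : M.cosyzygy.i ≫ ObjectProperty.homMk w = u ≫ M'.cosyzygy.i :=
    ObjectProperty.hom_ext _ hw
  have hip : M'.cosyzygy.i ≫ M'.cosyzygy.p = 0 := by
    ext x
    exact M'.cosyzygy.exact.apply_apply_eq_zero x
  obtain ⟨v, hv⟩ := M.cosyzygy.exists_desc (ObjectProperty.homMk w ≫ M'.cosyzygy.p) (by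
    rw [← Category.assoc, hw', Category.assoc, hip, Limits.comp_zero])
  exact ⟨v, _, hw', hv⟩

lemma Induced.id (M : Gp R) : Induced (𝟙 M) (𝟙 M.cosyzygy.N) := ⟨𝟙 _, by simp, by simp⟩

lemma Induced.comp {M M' M'' : Gp R} {u : M ⟶ M'} {u' : M' ⟶ M''} {v v'} (h : Induced u v)
    (h' : Induced u' v') : Induced (u ≫ u') (v ≫ v') := by
  obtain ⟨w, h₁, h₂⟩ := h
  obtain ⟨w', h₁', h₂'⟩ := h'
  refine ⟨w ≫ w', ?_, ?_⟩
  · rw [← Category.assoc, h₁, Category.assoc, h₁', Category.assoc]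
  · rw [← Category.assoc, h₂, Category.assoc, h₂', Category.assoc]

lemma Induced.sub {M M' : Gp R} {u u' : M ⟶ M'} {v v'} (h : Induced u v)
    (h' : Induced u' v') : Induced (u - u') (v - v') := by
  obtain ⟨w, h₁, h₂⟩ := h
  obtain ⟨w', h₁', h₂'⟩ := h'
  exact ⟨w - w', by simp [h₁, h₁'], by simp [h₂, h₂']⟩

/-- A morphism induced by a stably zero morphism is stably zero. -/
lemma Induced.stablyZero {M M' : Gp R} {u : M ⟶ M'} {v} (h : Induced u v) (hu : StablyZero u) :
    StablyZero v := by
  obtain ⟨w, h₁, h₂⟩ := h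
  obtain ⟨L, hL, hL', α, β, hαβ⟩ := hu
  obtain ⟨α', hα'⟩ := M.cosyzygy.exists_extend α
  have hip : M'.cosyzygy.i ≫ M'.cosyzygy.p = 0 := by
    ext x
    exact M'.cosyzygy.exact.apply_apply_eq_zero x
  let γ : M.cosyzygy.I ⟶ M' := ObjectProperty.homMk (α' ≫ β)
  have hγ : M.cosyzygy.i ≫ γ = u := ObjectProperty.hom_ext _ (by
    change M.cosyzygy.i.hom ≫ α' ≫ β = u.hom
    rw [← Category.assoc, hα', hαβ])
  obtain ⟨t, ht⟩ := M.cosyzygy.exists_desc (w - γ ≫ M'.cosyzygy.i) (by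
    rw [Preadditive.comp_sub, h₁, ← Category.assoc, hγ, sub_self])
  have hv : v = t ≫ M'.cosyzygy.p := by
    have key : M.cosyzygy.p ≫ v = M.cosyzygy.p ≫ t ≫ M'.cosyzygy.p := by
      rw [← Category.assoc, ht, h₂, Preadditive.sub_comp, Category.assoc, hip, Limits.comp_zero,
        sub_zero]
    ext x
    obtain ⟨y, rfl⟩ := M.cosyzygy.surjective x
    exact congrArg (fun g : M.cosyzygy.I ⟶ M'.cosyzygy.N => g.hom y) key
  exact ⟨M'.cosyzygy.I.obj, M'.cosyzygy.I.property.1, M'.cosyzygy.projective, t.hom,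
    M'.cosyzygy.p.hom, by rw [hv]; rfl⟩

/-- Morphisms induced by the same morphism are equal in the stable category. -/
lemma Induced.map_eq {M M' : Gp R} {u u' : M ⟶ M'} {v v'} (h : Induced u v)
    (h' : Induced u' v') (hu : stablyEqual R u u') :
    (CategoryTheory.Quotient.functor (stablyEqual R)).map v =
      (CategoryTheory.Quotient.functor (stablyEqual R)).map v' :=
  (CategoryTheory.Quotient.functor_map_eq_iff _ _ _).2 ((h.sub h').stablyZero hu)

end Gp

namespace StableGp

variable {R : Type u} [CommRing R]

/-- The suspension `Ω⁻¹` of the stable category: `M` goes to the chosen cosyzygy `Ω⁻¹M`, and the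
class of `u` goes to the class of any morphism induced by `u` on cosyzygies. -/
noncomputable def susp (R : Type u) [CommRing R] : StableGp R ⥤ StableGp R :=
  CategoryTheory.Quotient.lift _
    { obj := fun M => (CategoryTheory.Quotient.functor (Gp.stablyEqual R)).obj M.cosyzygy.N
      map := fun u => (CategoryTheory.Quotient.functor _).map (Gp.exists_induced u).choose
      map_id := fun M =>
        ((Gp.exists_induced (𝟙 M)).choose_spec.map_eq (Gp.Induced.id M)
          (Congruence.equivalence.refl _)).trans (CategoryTheory.Functor.map_id _ _)
      map_comp := fun u u' =>
        ((Gp.exists_induced (u ≫ u')).choose_spec.map_eq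
          ((Gp.exists_induced u).choose_spec.comp (Gp.exists_induced u').choose_spec)
          (Congruence.equivalence.refl _)).trans (Functor.map_comp _ _ _) }
    fun _ _ u u' h =>
      (Gp.exists_induced u).choose_spec.map_eq (Gp.exists_induced u').choose_spec h

/-- The triangle `M ⟶ M' ⟶ C ⟶ Ω⁻¹M` in the stable category given by morphisms of `Gp(R)`. -/
noncomputable def mkTriangle {M M' C : Gp R} (u : M ⟶ M') (v : M' ⟶ C)
    (w : C ⟶ M.cosyzygy.N) : SuspTriangle (susp R) where
  X := (CategoryTheory.Quotient.functor _).obj M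
  Y := (CategoryTheory.Quotient.functor _).obj M'
  Z := (CategoryTheory.Quotient.functor _).obj C
  mor₁ := (CategoryTheory.Quotient.functor _).map u
  mor₂ := (CategoryTheory.Quotient.functor _).map v
  mor₃ := (CategoryTheory.Quotient.functor _).map w

/-- The triangulated structure of the stable category of the Frobenius category `Gp(R)`. The
standard triangle `M ⟶ M' ⟶ C ⟶ Ω⁻¹M` of `u : M ⟶ M'` is given by the pushout `C` of `u` and
`M ⟶ I(M)`, where `w : C ⟶ Ω⁻¹M` is zero on `M'` and restricts to the projection on `I(M)`.
The exact triangles are those isomorphic to a standard one. -/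
noncomputable def triangleData (R : Type u) [CommRing R] : TriangleData (StableGp R) where
  susp := susp R
  exact := {t | ∃ (M M' C : Gp R) (u : M ⟶ M') (v : M' ⟶ C) (j : M.cosyzygy.I ⟶ C)
    (w : C ⟶ M.cosyzygy.N), IsPushout u M.cosyzygy.i v j ∧ v ≫ w = 0 ∧
      j ≫ w = M.cosyzygy.p ∧ t.Isomorphic (mkTriangle u v w)}

end StableGp

/-! ### Reduction modulo `ω` -/

section Reduction

variable {S : Type u} [CommRing S] {ω : S}

/-- An `S`-linear map between `S/(ω)`-modules is `S/(ω)`-linear. -/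
noncomputable abbrev toQuotLinear {M N : Type*} [AddCommGroup M] [AddCommGroup N] [Module S M]
    [Module S N] [Module (S ⧸ Ideal.span {ω}) M] [Module (S ⧸ Ideal.span {ω}) N]
    [IsScalarTower S (S ⧸ Ideal.span {ω}) M] [IsScalarTower S (S ⧸ Ideal.span {ω}) N]
    (g : M →ₗ[S] N) : M →ₗ[S ⧸ Ideal.span {ω}] N :=
  LinearMap.extendScalarsOfSurjective Ideal.Quotient.mk_surjective g

/-- The reduction `P/ωP`, a module over `S/(ω)`. -/
abbrev Red (ω : S) (P : Type*) [AddCommGroup P] [Module S P] :=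
  P ⧸ (Ideal.span {ω} • ⊤ : Submodule S P)

/-- The projection `P → P/ωP`. -/
abbrev redMk (ω : S) (P : Type*) [AddCommGroup P] [Module S P] : P →ₗ[S] Red ω P :=
  Submodule.mkQ _

variable {P P' : Type*} [AddCommGroup P] [Module S P] [AddCommGroup P'] [Module S P']

lemma redMk_eq_zero {x : P} : redMk ω P x = 0 ↔ ∃ y, ω • y = x := by
  simp [redMk, Submodule.ideal_span_singleton_smul, Submodule.mem_smul_pointwise_iff_exists]

lemma redMk_smul (x : P) : redMk ω P (ω • x) = 0 := redMk_eq_zero.2 ⟨x, rfl⟩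

lemma redMk_surjective : Function.Surjective (redMk ω P) := Submodule.mkQ_surjective _

/-- A linear map which kills `ωP` induces a map on `P/ωP`. -/
lemma exists_redLift {N : Type*} [AddCommGroup N] [Module S N] [Module (S ⧸ Ideal.span {ω}) N]
    [IsScalarTower S (S ⧸ Ideal.span {ω}) N] (g : P →ₗ[S] N) (hg : ∀ x, g (ω • x) = 0) :
    ∃ h : Red ω P →ₗ[S ⧸ Ideal.span {ω}] N, ∀ x, h (redMk ω P x) = g x :=
  ⟨toQuotLinear (Submodule.liftQ _ g fun x hx => by
    obtain ⟨y, rfl⟩ := redMk_eq_zero.1 ((Submodule.Quotient.mk_eq_zero _).2 hx)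
    exact hg y), fun _ => rfl⟩

/-- Coefficientwise reduction modulo `ω` of finitely supported functions. -/
noncomputable def redFinsupp (ω : S) (ι : Type*) :
    (ι →₀ S) →ₗ[S] (ι →₀ (S ⧸ Ideal.span {ω})) :=
  Finsupp.mapRange.linearMap (Algebra.linearMap S (S ⧸ Ideal.span {ω}))

lemma redFinsupp_surjective (ι : Type*) : Function.Surjective (redFinsupp ω ι) :=
  Finsupp.mapRange_surjective _ (map_zero (Ideal.Quotient.mk (Ideal.span {ω})))
    Ideal.Quotient.mk_surjective

lemma redFinsupp_smul {ι : Type*} (x : ι →₀ S) : redFinsupp ω ι (ω • x) = 0 := by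
  ext i
  exact Ideal.Quotient.eq_zero_iff_mem.2
    (Ideal.mem_span_singleton.2 ⟨x i, by simp⟩)

lemma exists_smul_of_redFinsupp_eq_zero {ι : Type*} (x : ι →₀ S) (hx : redFinsupp ω ι x = 0) :
    ∃ y : ι →₀ S, ω • y = x := by
  classical
  have h : ∀ i, ∃ s, ω * s = x i := fun i => by
    have h' : Ideal.Quotient.mk (Ideal.span {ω}) (x i) = 0 := DFunLike.congr_fun hx i
    rw [Ideal.Quotient.eq_zero_iff_mem, Ideal.mem_span_singleton] at h'
    obtain ⟨s, hs⟩ := h'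
    exact ⟨s, hs.symm⟩
  choose s hs using h
  refine ⟨Finsupp.onFinset x.support (fun i => if x i = 0 then 0 else s i) (fun i => ?_), ?_⟩
  · simp +contextual
  · ext i
    by_cases hi : x i = 0
    · simp [hi]
    · simp [hi, hs]

instance [Module.Projective S P] : Module.Projective (S ⧸ Ideal.span {ω}) (Red ω P) := by
  obtain ⟨s, hs⟩ := (inferInstance : Module.Projective S P)
  obtain ⟨σ, hσ⟩ := exists_redLift (redFinsupp ω P ∘ₗ s) fun x => by
    rw [map_smul, LinearMap.comp_apply, ← map_smul, redFinsupp_smul]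
  -- the retraction `R^(P) → P/ωP`
  let ρ : (P →₀ (S ⧸ Ideal.span {ω})) →ₗ[S ⧸ Ideal.span {ω}] Red ω P :=
    Finsupp.linearCombination _ (redMk ω P)
  refine Module.Projective.of_split σ ρ (LinearMap.ext fun x => ?_)
  obtain ⟨x, rfl⟩ := redMk_surjective x
  have key : ∀ y : P →₀ S, ρ (redFinsupp ω P y) =
      redMk ω P (Finsupp.linearCombination S id y) := by
    intro y
    induction y using Finsupp.induction_linear with
    | zero => simp only [map_zero]
    | add y z hy hz => simp only [map_add, hy, hz]
    | single a b =>
      have : redFinsupp ω P (Finsupp.single a b) =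
          Finsupp.single a (Ideal.Quotient.mk (Ideal.span {ω}) b) := by simp [redFinsupp]
      rw [this, Finsupp.linearCombination_single, Finsupp.linearCombination_single, map_smul]
      rfl
  rw [LinearMap.comp_apply, hσ, LinearMap.comp_apply, key, hs, LinearMap.id_apply]

/-- If `a b = ω`, then a map `g : P'/ωP' → L` to a projective module with `g a = 0` factors
through `b`. -/
lemma exists_red_factor (hω : ω ∈ nonZeroDivisors S) [Module.Projective S P]
    [Module.Projective S P'] (a : P →ₗ[S] P') (b : P' →ₗ[S] P) (hab : ∀ x, a (b x) = ω • x)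
    (a' : Red ω P →ₗ[S ⧸ Ideal.span {ω}] Red ω P')
    (b' : Red ω P' →ₗ[S ⧸ Ideal.span {ω}] Red ω P)
    (ha : ∀ x, a' (redMk ω P x) = redMk ω P' (a x))
    (hb : ∀ x, b' (redMk ω P' x) = redMk ω P (b x))
    {L : Type*} [AddCommGroup L] [Module (S ⧸ Ideal.span {ω}) L]
    (hL : Module.Projective (S ⧸ Ideal.span {ω}) L)
    (g : Red ω P' →ₗ[S ⧸ Ideal.span {ω}] L) (hg : g ∘ₗ a' = 0) :
    ∃ h : Red ω P →ₗ[S ⧸ Ideal.span {ω}] L, h ∘ₗ b' = g := by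
  obtain ⟨s, hs⟩ := hL
  obtain ⟨G, hG⟩ := Module.projective_lifting_property (redFinsupp ω L)
    ((s ∘ₗ g).restrictScalars S ∘ₗ redMk ω P') (redFinsupp_surjective L)
  replace hG : ∀ x, redFinsupp ω L (G x) = s (g (redMk ω P' x)) :=
    fun x => LinearMap.congr_fun hG x
  obtain ⟨H, hH⟩ := exists_lift_of_mem_range
    (ω • LinearMap.id : (L →₀ S) →ₗ[S] (L →₀ S)) (G ∘ₗ a) fun x => by
      obtain ⟨y, hy⟩ := exists_smul_of_redFinsupp_eq_zero (G (a x)) (by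
        have : g (a' (redMk ω P x)) = 0 := LinearMap.congr_fun hg _
        rw [hG, ← ha, this, map_zero])
      exact ⟨y, hy⟩
  have hHG : ∀ x, H (b x) = G x := fun x => by
    have h : ω • H (b x) = G (a (b x)) := hH (b x)
    rw [hab, map_smul] at h
    exact sub_eq_zero.1 (eq_zero_of_smul_eq_zero hω (by rw [smul_sub, h, sub_self]))
  obtain ⟨h, hh⟩ := exists_redLift (redFinsupp ω L ∘ₗ H) fun x => by
    rw [map_smul, LinearMap.comp_apply, ← map_smul, redFinsupp_smul]
  refine ⟨Finsupp.linearCombination _ id ∘ₗ h, LinearMap.ext fun x => ?_⟩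
  obtain ⟨x, rfl⟩ := redMk_surjective x
  rw [LinearMap.comp_apply, LinearMap.comp_apply, hb, hh, LinearMap.comp_apply, hHG, hG]
  exact hs _

end Reduction

/-! ### The cokernel functor -/

namespace MonProj

section Coker

variable {S : Type u} [CommRing S] {ω : S}

/-- The cokernel of `f : P → Q`. -/
abbrev Coker (X : MonProj S ω) : Type u := X.Q ⧸ LinearMap.range X.f

/-- The projection of `Q` onto the cokernel of `f : P → Q`. -/
abbrev cokerMk (X : MonProj S ω) : X.Q →ₗ[S] X.Coker := Submodule.mkQ _

lemma cokerMk_surjective (X : MonProj S ω) : Function.Surjective X.cokerMk :=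
  Submodule.mkQ_surjective _

lemma cokerMk_eq_zero (X : MonProj S ω) {x : X.Q} : X.cokerMk x = 0 ↔ ∃ p, X.f p = x :=
  Submodule.Quotient.mk_eq_zero _

/-- Since `ω` annihilates it, the cokernel is a module over `R = S/(ω)`. -/
noncomputable instance (X : MonProj S ω) : Module (S ⧸ Ideal.span {ω}) X.Coker :=
  Module.IsTorsionBy.module X.torsion

instance (X : MonProj S ω) : IsScalarTower S (S ⧸ Ideal.span {ω}) X.Coker :=
  Module.IsTorsionBySet.isScalarTower
    ((Module.isTorsionBySet_span_singleton_iff ω).2 X.torsion)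

instance (X : MonProj S ω) : Module.Finite (S ⧸ Ideal.span {ω}) X.Coker :=
  Module.Finite.of_restrictScalars_finite S _ _

/-- The map on cokernels induced by a morphism of `Mon(ω, 𝒫)`. -/
noncomputable def cokerMap {X Y : MonProj S ω} (ψ : X ⟶ Y) :
    X.Coker →ₗ[S ⧸ Ideal.span {ω}] Y.Coker :=
  toQuotLinear ((LinearMap.range X.f).mapQ (LinearMap.range Y.f) ψ.zero (by
    rintro _ ⟨p, rfl⟩
    exact ⟨ψ.one p, (ψ.comm p).symm⟩))

lemma cokerMap_mk {X Y : MonProj S ω} (ψ : X ⟶ Y) (q : X.Q) :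
    cokerMap ψ (X.cokerMk q) = Y.cokerMk (ψ.zero q) := rfl

/-- The cokernel of an object of `Mon(ω, 𝒫)` is a Gorenstein projective `R`-module: it is a syzygy
of the 2-periodic complex with terms `P/ωP` and `Q/ωQ`. -/
lemma gorensteinProjective_coker (hω : ω ∈ nonZeroDivisors S) (X : MonProj S ω) :
    gorensteinProjective (S ⧸ Ideal.span {ω})
      (ModuleCat.of (S ⧸ Ideal.span {ω}) X.Coker) := by
  obtain ⟨a, ha⟩ := exists_redLift (redMk ω X.Q ∘ₗ X.f) fun x => by
    rw [map_smul, LinearMap.comp_apply, ← map_smul, redMk_smul]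
  obtain ⟨b, hb⟩ := exists_redLift (redMk ω X.P ∘ₗ X.fSigma) fun x => by
    rw [map_smul, LinearMap.comp_apply, ← map_smul, redMk_smul]
  let i : X.Coker →ₗ[S ⧸ Ideal.span {ω}] Red ω X.P := toQuotLinear
    ((LinearMap.range X.f).liftQ (redMk ω X.P ∘ₗ X.fSigma) (by
      rintro _ ⟨p, rfl⟩
      rw [LinearMap.mem_ker, LinearMap.comp_apply, fSigma_f, redMk_smul]))
  have hi : ∀ q, i (X.cokerMk q) = redMk ω X.P (X.fSigma q) := fun _ => rfl
  have e₁ : Function.Exact a b := by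
    intro x
    obtain ⟨x, rfl⟩ := redMk_surjective x
    rw [hb, LinearMap.comp_apply, redMk_eq_zero]
    constructor
    · rintro ⟨p, hp⟩
      refine ⟨redMk ω X.P p, ?_⟩
      rw [ha, LinearMap.comp_apply, X.fSigma_injective hω ((X.fSigma_f p).trans hp)]
    · rintro ⟨p, hp⟩
      obtain ⟨p, rfl⟩ := redMk_surjective p
      rw [ha, LinearMap.comp_apply, ← sub_eq_zero, ← map_sub, redMk_eq_zero] at hp
      obtain ⟨y, hy⟩ := hp
      obtain rfl : x = X.f p - ω • y := by rw [hy]; abel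
      exact ⟨p - X.fSigma y, by simp [smul_sub]⟩
  have e₂ : Function.Exact b a := by
    intro x
    obtain ⟨x, rfl⟩ := redMk_surjective x
    rw [ha, LinearMap.comp_apply, redMk_eq_zero]
    constructor
    · rintro ⟨p, hp⟩
      refine ⟨redMk ω X.Q p, ?_⟩
      rw [hb, LinearMap.comp_apply, X.injective ((X.f_fSigma p).trans hp)]
    · rintro ⟨p, hp⟩
      obtain ⟨p, rfl⟩ := redMk_surjective p
      rw [hb, LinearMap.comp_apply, ← sub_eq_zero, ← map_sub, redMk_eq_zero] at hp
      obtain ⟨y, hy⟩ := hp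
      obtain rfl : x = X.fSigma p - ω • y := by rw [hy]; abel
      exact ⟨p - X.f y, by simp [smul_sub]⟩
  have e₃ : Function.Exact i a := by
    intro x
    refine (e₂ x).trans ⟨?_, ?_⟩
    · rintro ⟨p, rfl⟩
      obtain ⟨p, rfl⟩ := redMk_surjective p
      exact ⟨X.cokerMk p, by rw [hi, hb]; rfl⟩
    · rintro ⟨p, rfl⟩
      obtain ⟨p, rfl⟩ := X.cokerMk_surjective p
      exact ⟨redMk ω X.Q p, by rw [hi, hb]; rfl⟩
  have e₄ : Function.Injective i := by
    rw [injective_iff_map_eq_zero]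
    intro x hx
    obtain ⟨x, rfl⟩ := X.cokerMk_surjective x
    rw [hi, redMk_eq_zero] at hx
    obtain ⟨y, hy⟩ := hx
    exact X.cokerMk_eq_zero.2 ⟨y, X.fSigma_injective hω ((X.fSigma_f y).trans hy)⟩
  exact gorensteinProjective_of_periodic
    (A := ModuleCat.of (S ⧸ Ideal.span {ω}) (Red ω X.P))
    (B := ModuleCat.of (S ⧸ Ideal.span {ω}) (Red ω X.Q))
    (M := ModuleCat.of (S ⧸ Ideal.span {ω}) X.Coker) a b e₁ e₂
    (fun _ hL => exists_red_factor hω X.f X.fSigma X.f_fSigma a b ha hb hL)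
    (fun _ hL => exists_red_factor hω X.fSigma X.f X.fSigma_f b a hb ha hL) i e₄ e₃

/-- The functor `Mon(ω, 𝒫) ⥤ Gp(R)` taking `(f : P → Q)` to `Coker f`. -/
noncomputable def cokerFunctor (hω : ω ∈ nonZeroDivisors S) :
    MonProj S ω ⥤ Gp (S ⧸ Ideal.span {ω}) where
  obj X := ⟨ModuleCat.of (S ⧸ Ideal.span {ω}) X.Coker, X.gorensteinProjective_coker hω⟩
  map ψ := ObjectProperty.homMk (ModuleCat.ofHom (cokerMap ψ))
  map_id X := by
    refine ObjectProperty.hom_ext _ (ModuleCat.hom_ext (LinearMap.ext fun x => ?_))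
    obtain ⟨x, rfl⟩ := X.cokerMk_surjective x
    rfl
  map_comp {X _ _} φ ψ := by
    refine ObjectProperty.hom_ext _ (ModuleCat.hom_ext (LinearMap.ext fun x => ?_))
    obtain ⟨x, rfl⟩ := X.cokerMk_surjective x
    rfl

/-- The map on cokernels of a null-homotopic morphism factors through `Q'/ωQ'`. -/
lemma NullHomotopic.stablyZero (hω : ω ∈ nonZeroDivisors S) {X Y : MonProj S ω} {ψ : X ⟶ Y}
    (h : NullHomotopic ψ) : Gp.StablyZero ((cokerFunctor hω).map ψ) := by
  obtain ⟨s₁, s₀, h⟩ := h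
  let α : X.Coker →ₗ[S ⧸ Ideal.span {ω}] Red ω Y.Q := toQuotLinear
    ((LinearMap.range X.f).liftQ (redMk ω Y.Q ∘ₗ (ψ.zero - Y.f ∘ₗ s₀)) (by
      rintro _ ⟨p, rfl⟩
      rw [LinearMap.mem_ker, LinearMap.comp_apply, LinearMap.sub_apply, ψ.comm,
        LinearMap.comp_apply, h, redMk_smul]))
  obtain ⟨β, hβ⟩ := exists_redLift Y.cokerMk fun q =>
    Y.cokerMk_eq_zero.2 ⟨Y.fSigma q, Y.f_fSigma q⟩
  refine ⟨ModuleCat.of (S ⧸ Ideal.span {ω}) (Red ω Y.Q),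
    inferInstanceAs (Module.Finite (S ⧸ Ideal.span {ω}) (Red ω Y.Q)),
    inferInstanceAs (Module.Projective (S ⧸ Ideal.span {ω}) (Red ω Y.Q)),
    ModuleCat.ofHom α, ModuleCat.ofHom β, ModuleCat.hom_ext (LinearMap.ext fun x => ?_)⟩
  obtain ⟨x, rfl⟩ := X.cokerMk_surjective x
  change Y.cokerMk (ψ.zero x) = β (redMk ω Y.Q (ψ.zero x - Y.f (s₀ x)))
  rw [hβ, map_sub, Y.cokerMk_eq_zero.2 ⟨s₀ x, rfl⟩, sub_zero]

lemma cokerFunctor_map_sub (hω : ω ∈ nonZeroDivisors S) {X Y : MonProj S ω} (φ ψ : X ⟶ Y) :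
    (cokerFunctor hω).map (φ - ψ) = (cokerFunctor hω).map φ - (cokerFunctor hω).map ψ := by
  refine ObjectProperty.hom_ext _ (ModuleCat.hom_ext (LinearMap.ext fun x => ?_))
  obtain ⟨x, rfl⟩ := X.cokerMk_surjective x
  rfl

end Coker

end MonProj

/-- The functor `T` from `HMon(ω, 𝒫)` to the stable category of `Gp(R)`, with `R = S/(ω)`, which
takes `(f : P → Q)` to `Coker f` and the class of `(ψ₁, ψ₀)` to the class of the induced map. -/
noncomputable def HMon.T {S : Type u} [CommRing S] {ω : S} (hω : ω ∈ nonZeroDivisors S) :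
    HMon S ω ⥤ StableGp (S ⧸ Ideal.span {ω}) :=
  CategoryTheory.Quotient.lift _
    (MonProj.cokerFunctor hω ⋙ CategoryTheory.Quotient.functor _) fun _ _ φ ψ h =>
      (CategoryTheory.Quotient.functor_map_eq_iff _ _ _).2 (by
        change Gp.StablyZero _
        rw [← MonProj.cokerFunctor_map_sub]
        exact MonProj.NullHomotopic.stablyZero hω h)

/-! An object `f : P → Q` carries its own cosyzygy: `f_Σ` induces a short exact sequence `0 → Coker
f → P/ωP → Coker(-f_Σ) → 0` with middle term projective over `R = S/(ω)` (`MonProj.cosyzygy`). It is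
functorial in `f`, since `ψ₁` reduced modulo `ω` gives the middle map (`cosyzygy_induced`). Two
cosyzygies of one module are canonically isomorphic in the stable category (`stableIso`), and
comparing this one with the chosen one yields the natural isomorphism `ζ`.

The cone is the same construction one level up. The columns of `c` say that in `Coker c` the image
of `f'` vanishes and `(ψ₀ q, 0)` is identified with `(0, f_Σ q)`; so `Coker c` is the pushout of
`Coker f' ← Coker f → P/ωP` (`isPushout_cone`). Thus `T` sends a standard triangle to the triangle
of a pushout along the explicit cosyzygy, and `isomorphic_mkTriangle` replaces that cosyzygy by the
chosen one, up to stable isomorphism.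

It remains to see that the pushout `C` along the chosen cosyzygy `0 → M → I → N → 0` lies in `Gp(R)`
(`exists_standard_pushout`). The comparison of pushouts exhibits `C` as a retract of `Coker c ⊕ I`.
Both summands have projective dimension at most one over `S`, hence so does `C`. A finitely
generated `R`-module with this property is the cokernel of an object of `Mon(ω, 𝒫)`, and such
cokernels are Gorenstein projective. -/

/-! ### Comparison of pushouts along different cosyzygies -/

/-- Let `C'` and `C` be the pushouts of `u : M ⟶ M'` along `M ⟶ I'` and `M ⟶ I`, and let
`k : I' ⟶ I` and `l : I ⟶ I'` be morphisms under `M` such that `k ≫ l - 𝟙` factors as `p ≫ t`.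
Then the comparison morphisms compose to the identity up to a morphism that factors through
`t`. -/
lemma CategoryTheory.IsPushout.comparison {𝒜 : Type*} [Category* 𝒜] [Preadditive 𝒜]
    {M M' I I' C C' N : 𝒜} {u : M ⟶ M'} {i' : M ⟶ I'} {v' : M' ⟶ C'} {j' : I' ⟶ C'}
    {v : M' ⟶ C} {j : I ⟶ C} (H' : IsPushout u i' v' j')
    {k : I' ⟶ I} {l : I ⟶ I'} {g : C' ⟶ C} {g' : C ⟶ C'}
    (hvg : v' ≫ g = v) (hjg : j' ≫ g = k ≫ j) (hvg' : v ≫ g' = v') (hjg' : j ≫ g' = l ≫ j')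
    {p : I' ⟶ N} {t : N ⟶ I'} (hkl : k ≫ l - 𝟙 I' = p ≫ t)
    {w : C' ⟶ N} (hvw : v' ≫ w = 0) (hjw : j' ≫ w = p) :
    g ≫ g' - 𝟙 C' = w ≫ t ≫ j' := by
  -- Test on the two legs: both sides vanish on `M'`, and on `I'` both become `(k ≫ l - 𝟙) ≫ j' = p
  -- ≫ t ≫ j'`.
  refine H'.hom_ext ?_ ?_
  · rw [Preadditive.comp_sub, reassoc_of% hvg, hvg', Category.comp_id, sub_self,
      reassoc_of% hvw, Limits.zero_comp]
  · rw [Preadditive.comp_sub, reassoc_of% hjg, hjg', Category.comp_id, reassoc_of% hjw,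
      ← Category.assoc p, ← hkl, Preadditive.sub_comp, Category.assoc, Category.id_comp]

/-! ### Independence of the choice of cosyzygy -/

namespace Gp

variable {R : Type u} [CommRing R]

lemma Cosyzygy.comp_zero {M : Gp R} (c : Cosyzygy M) : c.i ≫ c.p = 0 := by
  ext x
  exact c.exact.apply_apply_eq_zero x

lemma Cosyzygy.hom_ext {M L : Gp R} (c : Cosyzygy M) {f g : c.N ⟶ L} (h : c.p ≫ f = c.p ≫ g) :
    f = g := by
  ext x
  obtain ⟨y, rfl⟩ := c.surjective x
  exact congrArg (fun g : c.I ⟶ L => g.hom y) h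

/-- `w` and `v` are the components on the middle and right terms of a morphism of short exact
sequences from the cosyzygy `c` to the cosyzygy `c'` which is `u` on the left terms. -/
structure Cosyzygy.Induced {M M' : Gp R} (c : Cosyzygy M) (c' : Cosyzygy M') (u : M ⟶ M')
    (w : c.I ⟶ c'.I) (v : c.N ⟶ c'.N) : Prop where
  i_comp : c.i ≫ w = u ≫ c'.i
  p_comp : c.p ≫ v = w ≫ c'.p

namespace Cosyzygy

variable {M M' M'' : Gp R} {c : Cosyzygy M} {c' : Cosyzygy M'} {c'' : Cosyzygy M''}

/-- Because `c.N` is Gorenstein projective, `u ≫ c'.i` extends over `c.I` to the projective `c'.I`;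
the extension followed by `c'.p` kills `M` and so descends to `c.N`. -/
lemma exists_induced (c : Cosyzygy M) (c' : Cosyzygy M') (u : M ⟶ M') :
    ∃ w v, c.Induced c' u w v := by
  have := c'.projective
  obtain ⟨w, hw⟩ := c.exists_extend (u ≫ c'.i).hom
  have hw' : c.i ≫ ObjectProperty.homMk w = u ≫ c'.i := ObjectProperty.hom_ext _ hw
  obtain ⟨v, hv⟩ := c.exists_desc (ObjectProperty.homMk w ≫ c'.p) (by
    rw [← Category.assoc, hw', Category.assoc, c'.comp_zero, Limits.comp_zero])
  exact ⟨_, v, hw', hv⟩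

lemma Induced.id (c : Cosyzygy M) : c.Induced c (𝟙 M) (𝟙 _) (𝟙 _) := ⟨by simp, by simp⟩

lemma Induced.comp {u : M ⟶ M'} {u' : M' ⟶ M''} {w w' v v'} (h : c.Induced c' u w v)
    (h' : c'.Induced c'' u' w' v') : c.Induced c'' (u ≫ u') (w ≫ w') (v ≫ v') where
  i_comp := by rw [reassoc_of% h.i_comp, h'.i_comp, Category.assoc]
  p_comp := by rw [reassoc_of% h.p_comp, h'.p_comp, Category.assoc]

/-- Two morphisms of short exact sequences which agree on the left are homotopic. -/
lemma Induced.exists_homotopy {u : M ⟶ M'} {w w' v v'} (h : c.Induced c' u w v)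
    (h' : c.Induced c' u w' v') : ∃ t : c.N ⟶ c'.I, w - w' = c.p ≫ t ∧ v - v' = t ≫ c'.p := by
  obtain ⟨t, ht⟩ := c.exists_desc (w - w') (by
    rw [Preadditive.comp_sub, h.i_comp, h'.i_comp, sub_self])
  refine ⟨t, ht.symm, c.hom_ext ?_⟩
  rw [reassoc_of% ht, Preadditive.comp_sub, h.p_comp, h'.p_comp, Preadditive.sub_comp]

lemma stablyZero_comp (c : Cosyzygy M) (t : M' ⟶ c.I) (q : c.I ⟶ M'') :
    StablyZero (t ≫ q) :=
  ⟨c.I.obj, c.I.property.1, c.projective, t.hom, q.hom, rfl⟩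

/-- The homotopy writes `v - v'` as a map through the projective `c'.I`; hence the stable class of
the right-hand map depends on `u` alone. -/
lemma Induced.map_eq {u : M ⟶ M'} {w w' v v'} (h : c.Induced c' u w v)
    (h' : c.Induced c' u w' v') :
    (CategoryTheory.Quotient.functor (stablyEqual R)).map v =
      (CategoryTheory.Quotient.functor (stablyEqual R)).map v' := by
  obtain ⟨t, -, ht⟩ := h.exists_homotopy h'
  refine (CategoryTheory.Quotient.functor_map_eq_iff _ _ _).2 ?_
  change StablyZero _
  rw [ht]
  exact c'.stablyZero_comp _ _

/-- The isomorphism in the stable category between two cosyzygies of the same module. -/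
noncomputable def stableIso (c c' : Cosyzygy M) :
    (CategoryTheory.Quotient.functor (stablyEqual R)).obj c.N ≅
      (CategoryTheory.Quotient.functor (stablyEqual R)).obj c'.N where
  hom := (CategoryTheory.Quotient.functor _).map (c.exists_induced c' (𝟙 M)).choose_spec.choose
  inv := (CategoryTheory.Quotient.functor _).map (c'.exists_induced c (𝟙 M)).choose_spec.choose
  hom_inv_id := by
    rw [← Functor.map_comp, ← CategoryTheory.Functor.map_id]
    have h := (c.exists_induced c' (𝟙 M)).choose_spec.choose_spec.comp
      (c'.exists_induced c (𝟙 M)).choose_spec.choose_spec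
    rw [Category.comp_id] at h
    exact h.map_eq (.id c)
  inv_hom_id := by
    rw [← Functor.map_comp, ← CategoryTheory.Functor.map_id]
    have h := (c'.exists_induced c (𝟙 M)).choose_spec.choose_spec.comp
      (c.exists_induced c' (𝟙 M)).choose_spec.choose_spec
    rw [Category.comp_id] at h
    exact h.map_eq (.id c')

/-- Lets any convenient lift of the identity stand for the one chosen in `stableIso`; the next lemma
does the same for the suspension functor. -/
lemma Induced.map_eq_stableIso {c c' : Cosyzygy M} {w v} (h : c.Induced c' (𝟙 M) w v) :
    (CategoryTheory.Quotient.functor (stablyEqual R)).map v = (c.stableIso c').hom :=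
  h.map_eq (c.exists_induced c' (𝟙 M)).choose_spec.choose_spec

lemma Induced.map_eq_susp_map {u : M ⟶ M'} {w v}
    (h : M.cosyzygy.Induced M'.cosyzygy u w v) :
    (CategoryTheory.Quotient.functor (stablyEqual R)).map v =
      (StableGp.susp R).map ((CategoryTheory.Quotient.functor (stablyEqual R)).map u) :=
  Gp.Induced.map_eq ⟨w, h.i_comp, h.p_comp⟩ (Gp.exists_induced u).choose_spec
    (Congruence.equivalence.refl _)

/-- The isomorphism from a cosyzygy to the chosen one is natural. -/
lemma Induced.stableIso_naturality {u : M ⟶ M'} {w v} (h : c.Induced c' u w v) :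
    (CategoryTheory.Quotient.functor (stablyEqual R)).map v ≫
        (c'.stableIso M'.cosyzygy).hom =
      (c.stableIso M.cosyzygy).hom ≫
        (StableGp.susp R).map ((CategoryTheory.Quotient.functor (stablyEqual R)).map u) := by
  obtain ⟨w₁, v₁, h₁⟩ := c.exists_induced M.cosyzygy (𝟙 M)
  obtain ⟨w₂, v₂, h₂⟩ := c'.exists_induced M'.cosyzygy (𝟙 M')
  obtain ⟨w₃, v₃, h₃⟩ := M.cosyzygy.exists_induced M'.cosyzygy u
  -- Both ways around the square are right-hand parts of morphisms of sequences from `c` to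
  -- `M'.cosyzygy` over the same `u`, so they agree stably.
  have e₁ := h.comp h₂
  have e₂ := h₁.comp h₃
  rw [Category.comp_id] at e₁
  rw [Category.id_comp] at e₂
  rw [← h₁.map_eq_stableIso, ← h₂.map_eq_stableIso, ← h₃.map_eq_susp_map]
  exact (Functor.map_comp _ _ _).symm.trans ((e₁.map_eq e₂).trans (Functor.map_comp _ _ _))

lemma exists_iso_hom_eq_map {C C' : Gp R} {g : C ⟶ C'} {g' : C' ⟶ C}
    (h : StablyZero (g ≫ g' - 𝟙 C)) (h' : StablyZero (g' ≫ g - 𝟙 C')) :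
    ∃ e : (CategoryTheory.Quotient.functor (stablyEqual R)).obj C ≅
        (CategoryTheory.Quotient.functor (stablyEqual R)).obj C',
      e.hom = (CategoryTheory.Quotient.functor (stablyEqual R)).map g :=
  ⟨{ hom := (CategoryTheory.Quotient.functor (stablyEqual R)).map g
     inv := (CategoryTheory.Quotient.functor (stablyEqual R)).map g'
     hom_inv_id := by
      rw [← Functor.map_comp, ← CategoryTheory.Functor.map_id]
      exact (CategoryTheory.Quotient.functor_map_eq_iff _ _ _).2 h
     inv_hom_id := by
      rw [← Functor.map_comp, ← CategoryTheory.Functor.map_id]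
      exact (CategoryTheory.Quotient.functor_map_eq_iff _ _ _).2 h' }, rfl⟩

/-- The triangle of a pushout along an arbitrary cosyzygy is isomorphic to the standard triangle,
which is given by the pushout along the chosen cosyzygy. -/
lemma isomorphic_mkTriangle {C C' : Gp R} {u : M ⟶ M'} {v' : M' ⟶ C'} {j' : c.I ⟶ C'}
    {w' : C' ⟶ c.N} (H' : IsPushout u c.i v' j') (hvw' : v' ≫ w' = 0) (hjw' : j' ≫ w' = c.p)
    {v : M' ⟶ C} {j : M.cosyzygy.I ⟶ C} {w : C ⟶ M.cosyzygy.N}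
    (H : IsPushout u M.cosyzygy.i v j) (hvw : v ≫ w = 0) (hjw : j ≫ w = M.cosyzygy.p)
    -- The triangle is a variable with an equation because the image of a standard triangle has this
    -- shape only after unfolding.
    (t : SuspTriangle (StableGp.susp R))
    (ht : t = { X := (CategoryTheory.Quotient.functor _).obj M
                Y := (CategoryTheory.Quotient.functor _).obj M'
                Z := (CategoryTheory.Quotient.functor _).obj C'
                mor₁ := (CategoryTheory.Quotient.functor _).map u
                mor₂ := (CategoryTheory.Quotient.functor _).map v'
                mor₃ := (CategoryTheory.Quotient.functor _).map w' ≫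
                  (c.stableIso M.cosyzygy).hom }) :
    t.Isomorphic (StableGp.mkTriangle u v w) := by
  subst ht
  obtain ⟨k, s, hk⟩ := c.exists_induced M.cosyzygy (𝟙 M)
  obtain ⟨l, r, hl⟩ := M.cosyzygy.exists_induced c (𝟙 M)
  -- Both round trips between the two sequences lift `𝟙 M`, so on the middle terms they differ from
  -- the identity by maps factoring through `p`. This is what `IsPushout.comparison` requires.
  obtain ⟨τ, hτ, -⟩ := Induced.exists_homotopy
    (by simpa using hk.comp hl : c.Induced c (𝟙 M) (k ≫ l) (s ≫ r)) (.id c)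
  obtain ⟨τ', hτ', -⟩ := Induced.exists_homotopy
    (by simpa using hl.comp hk : M.cosyzygy.Induced _ (𝟙 M) (l ≫ k) (r ≫ s)) (.id _)
  let g : C' ⟶ C := H'.desc v (k ≫ j) (by
    rw [reassoc_of% hk.i_comp, H.w])
  have hvg : v' ≫ g = v := H'.inl_desc _ _ _
  have hjg : j' ≫ g = k ≫ j := H'.inr_desc _ _ _
  let g' : C ⟶ C' := H.desc v' (l ≫ j') (by
    rw [reassoc_of% hl.i_comp, H'.w])
  have hvg' : v ≫ g' = v' := H.inl_desc _ _ _
  have hjg' : j ≫ g' = l ≫ j' := H.inr_desc _ _ _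
  -- The errors `w' ≫ τ ≫ j'` and `w ≫ τ' ≫ j` pass through the projective middle terms, so `g` and
  -- `g'` are mutually inverse in the stable category.
  obtain ⟨e, he⟩ := exists_iso_hom_eq_map (g := g) (g' := g')
    (by rw [H'.comparison hvg hjg hvg' hjg' hτ hvw' hjw', ← Category.assoc]
        exact c.stablyZero_comp _ _)
    (by rw [H.comparison hvg' hjg' hvg hjg hτ' hvw hjw, ← Category.assoc]
        exact M.cosyzygy.stablyZero_comp _ _)
  -- This is the third square: the class of `s` is `stableIso`, the correction built into the third
  -- map of `t`.
  have hgw : g ≫ w = w' ≫ s := by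
    refine H'.hom_ext ?_ ?_
    · rw [reassoc_of% hvg, hvw, reassoc_of% hvw', Limits.zero_comp]
    · rw [reassoc_of% hjg, hjw, reassoc_of% hjw', hk.p_comp]
  refine ⟨Iso.refl _, Iso.refl _, e, ?_, ?_, ?_⟩
  · exact (Category.comp_id _).trans (Category.id_comp _).symm
  · change (CategoryTheory.Quotient.functor _).map v' ≫ e.hom =
      𝟙 _ ≫ (CategoryTheory.Quotient.functor _).map v
    rw [he, ← Functor.map_comp, hvg, Category.id_comp]
  · change ((CategoryTheory.Quotient.functor _).map w' ≫ (c.stableIso M.cosyzygy).hom) ≫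
      (StableGp.susp R).map (𝟙 _) = e.hom ≫ (CategoryTheory.Quotient.functor _).map w
    rw [he, ← Functor.map_comp, hgw, Functor.map_comp, ← hk.map_eq_stableIso]
    exact (congrArg _ (CategoryTheory.Functor.map_id _ _)).trans (Category.comp_id _)

end Cosyzygy

end Gp

/-! ### Isomorphisms of triangles -/

namespace SuspTriangle

variable {C : Type*} [Category* C] {susp : C ⥤ C}

lemma Isomorphic.trans {t t' t'' : SuspTriangle susp} (h : t.Isomorphic t')
    (h' : t'.Isomorphic t'') : t.Isomorphic t'' := by
  obtain ⟨a, b, c, h₁, h₂, h₃⟩ := h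
  obtain ⟨a', b', c', h₁', h₂', h₃'⟩ := h'
  refine ⟨a ≪≫ a', b ≪≫ b', c ≪≫ c', ?_, ?_, ?_⟩
  · simp [reassoc_of% h₁, h₁']
  · simp [reassoc_of% h₂, h₂']
  · simp [reassoc_of% h₃, h₃']

/-- The first two squares are functoriality; the third also uses naturality of `ζ` at the
isomorphism of first terms. -/
lemma Isomorphic.map {D : Type*} [Category* D] {susp' : D ⥤ D} (F : C ⥤ D)
    (ζ : susp ⋙ F ≅ F ⋙ susp') {t t' : SuspTriangle susp} (h : t.Isomorphic t') :
    (t.map F ζ).Isomorphic (t'.map F ζ) := by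
  obtain ⟨a, b, c, h₁, h₂, h₃⟩ := h
  refine ⟨F.mapIso a, F.mapIso b, F.mapIso c, ?_, ?_, ?_⟩
  · simp [SuspTriangle.map, ← Functor.map_comp, h₁]
  · simp [SuspTriangle.map, ← Functor.map_comp, h₂]
  · have := ζ.hom.naturality a.hom
    dsimp [SuspTriangle.map] at this ⊢
    rw [Category.assoc, ← this, ← Functor.map_comp_assoc, h₃, Functor.map_comp_assoc]

end SuspTriangle

/-! ### Recognising pushouts of modules -/

/-- A linear map that vanishes on the kernel of a surjective linear map factors through it. -/
lemma LinearMap.exists_comp_eq_of_ker_le {R M N L : Type*} [CommRing R] [AddCommGroup M]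
    [AddCommGroup N] [AddCommGroup L] [Module R M] [Module R N] [Module R L] (π : M →ₗ[R] N)
    (hπ : Function.Surjective π) (g : M →ₗ[R] L) (h : LinearMap.ker π ≤ LinearMap.ker g) :
    ∃ d : N →ₗ[R] L, ∀ x, d (π x) = g x := by
  refine ⟨(LinearMap.ker π).liftQ g h ∘ₗ (π.quotKerEquivOfSurjective hπ).symm.toLinearMap,
    fun x => ?_⟩
  have : (π.quotKerEquivOfSurjective hπ).symm (π x) = Submodule.Quotient.mk x := by
    rw [LinearEquiv.symm_apply_eq]
    rfl
  simp [this]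

/-- A commutative square of modules is a pushout if the map `[v j] : M' ⊕ I → C` is surjective and
its kernel consists of the elements `(u m, -i m)`. -/
lemma ModuleCat.isPushout_of_exact {R : Type u} [CommRing R] {M M' I C : ModuleCat.{u} R}
    {u : M ⟶ M'} {i : M ⟶ I} {v : M' ⟶ C} {j : I ⟶ C} (w : u ≫ v = i ≫ j)
    (hs : ∀ z, ∃ y x, v y + j x = z)
    (he : ∀ y x, v y + j x = 0 → ∃ m, u m = y ∧ i m = -x) : IsPushout u i v j := by
  have key (s : Limits.PushoutCocone u i) : ∃ d : C ⟶ s.pt, v ≫ d = s.inl ∧ j ≫ d = s.inr := by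
    -- The cocone condition says that `[inl inr]` kills every `(u m, -i m)`, hence the whole kernel
    -- of `[v j]`.
    obtain ⟨d, hd⟩ := LinearMap.exists_comp_eq_of_ker_le (v.hom.coprod j.hom) (fun z => by
      obtain ⟨y, x, h⟩ := hs z
      exact ⟨(y, x), h⟩) (s.inl.hom.coprod s.inr.hom) (by
        rintro ⟨y, x⟩ h
        obtain ⟨m, rfl, hx⟩ := he y x h
        have hm : s.inl (u m) = s.inr (i m) := congrArg (fun g : M ⟶ s.pt => g m) s.condition
        change s.inl (u m) + s.inr x = 0
        rw [hm, hx, map_neg, neg_add_cancel])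
    refine ⟨ModuleCat.ofHom d, ?_, ?_⟩
    · ext y
      simpa using hd (y, 0)
    · ext x
      simpa using hd (0, x)
  choose d hd using key
  refine ⟨⟨w⟩, ⟨Limits.PushoutCocone.IsColimit.mk w d (fun s => (hd s).1) (fun s => (hd s).2) ?_⟩⟩
  intro s m h₁ h₂
  ext z
  obtain ⟨y, x, rfl⟩ := hs z
  rw [map_add, map_add]
  exact congrArg₂ (· + ·) (congrArg (fun g : M' ⟶ s.pt => g y) (h₁.trans (hd s).1.symm))
    (congrArg (fun g : I ⟶ s.pt => g x) (h₂.trans (hd s).2.symm))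

/-! ### The explicit cosyzygy and the cokernel of the mapping cone -/

namespace MonProj

section Cosyzygy

variable {S : Type u} [CommRing S] {ω : S}

/-- The map from `Coker f` to `P/ωP` induced by `f_Σ`. -/
noncomputable def cokerToRed (X : MonProj S ω) : X.Coker →ₗ[S ⧸ Ideal.span {ω}] Red ω X.P :=
  toQuotLinear ((LinearMap.range X.f).liftQ (redMk ω X.P ∘ₗ X.fSigma) (by
    rintro _ ⟨p, rfl⟩
    rw [LinearMap.mem_ker, LinearMap.comp_apply, fSigma_f, redMk_smul]))

lemma cokerToRed_mk (X : MonProj S ω) (q : X.Q) :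
    X.cokerToRed (X.cokerMk q) = redMk ω X.P (X.fSigma q) := rfl

/-- If `f_Σ q = ω y`, then `f_Σ q = f_Σ (f y)`; as `f_Σ` is injective, `q = f y` vanishes in the
cokernel. -/
lemma cokerToRed_injective (hω : ω ∈ nonZeroDivisors S) (X : MonProj S ω) :
    Function.Injective X.cokerToRed := by
  rw [injective_iff_map_eq_zero]
  intro x hx
  obtain ⟨x, rfl⟩ := X.cokerMk_surjective x
  rw [cokerToRed_mk, redMk_eq_zero] at hx
  obtain ⟨y, hy⟩ := hx
  exact X.cokerMk_eq_zero.2 ⟨y, X.fSigma_injective hω ((X.fSigma_f y).trans hy)⟩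

/-- The map from `Q/ωQ` to `Coker f` induced by the projection. -/
noncomputable def redToCoker (X : MonProj S ω) : Red ω X.Q →ₗ[S ⧸ Ideal.span {ω}] X.Coker :=
  toQuotLinear (Submodule.liftQ _ X.cokerMk (by
    intro x hx
    obtain ⟨y, rfl⟩ := redMk_eq_zero.1 ((Submodule.Quotient.mk_eq_zero _).2 hx)
    exact X.cokerMk_eq_zero.2 (X.smul_mem_range y)))

/-- The short exact sequence `0 → Coker f → P/ωP → Coker (-f_Σ) → 0`. -/
noncomputable def cosyzygy (hω : ω ∈ nonZeroDivisors S) (X : MonProj S ω) :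
    Gp.Cosyzygy ((cokerFunctor hω).obj X) where
  I := ⟨ModuleCat.of (S ⧸ Ideal.span {ω}) (Red ω X.P),
    @gorensteinProjective_of_projective _ _ _
      (inferInstanceAs (Module.Finite (S ⧸ Ideal.span {ω}) (Red ω X.P)))
      (inferInstanceAs (Module.Projective (S ⧸ Ideal.span {ω}) (Red ω X.P)))⟩
  N := (cokerFunctor hω).obj ((susp hω).obj X)
  i := ObjectProperty.homMk (ModuleCat.ofHom X.cokerToRed)
  p := ObjectProperty.homMk (ModuleCat.ofHom ((susp hω).obj X).redToCoker)
  projective := inferInstanceAs (Module.Projective (S ⧸ Ideal.span {ω}) (Red ω X.P))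
  injective := X.cokerToRed_injective hω
  exact := by
    change Function.Exact X.cokerToRed ((susp hω).obj X).redToCoker
    intro x
    obtain ⟨x, rfl⟩ := redMk_surjective x
    refine (cokerMk_eq_zero ((susp hω).obj X)).trans ⟨?_, ?_⟩
    · rintro ⟨q, rfl⟩
      exact ⟨X.cokerMk (-q), congrArg (redMk ω X.P) (map_neg X.fSigma q)⟩
    · rintro ⟨q, hq⟩
      obtain ⟨q, rfl⟩ := X.cokerMk_surjective q
      rw [cokerToRed_mk, ← sub_eq_zero, ← map_sub, redMk_eq_zero] at hq
      obtain ⟨y, hy⟩ := hq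
      -- Here `ω y = f_Σ q - x` and `ω y = f_Σ (f y)`, so `x = f_Σ (q - f y)`; the sign is that of
      -- `-f_Σ`.
      refine ⟨X.f y - q, ?_⟩
      change -X.fSigma (X.f y - q) = x
      rw [map_sub, fSigma_f, hy]
      abel
  surjective := by
    change Function.Surjective ((susp hω).obj X).redToCoker
    intro x
    obtain ⟨x, rfl⟩ := cokerMk_surjective _ x
    exact ⟨redMk ω _ x, rfl⟩

/-- The middle map is `ψ₁` modulo `ω`. The left square is `ψ₁ f_Σ = f'_Σ ψ₀`, and the right one
holds on representatives because `Σψ` has `ψ₁` as its map of targets. This is the source of the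
naturality of `ζ`. -/
lemma cosyzygy_induced (hω : ω ∈ nonZeroDivisors S) {X Y : MonProj S ω} (ψ : X ⟶ Y) :
    ∃ w, (X.cosyzygy hω).Induced (Y.cosyzygy hω) ((cokerFunctor hω).map ψ) w
      ((cokerFunctor hω).map ((susp hω).map ψ)) := by
  obtain ⟨w, hw⟩ := exists_redLift (redMk ω Y.P ∘ₗ ψ.one) fun x => by
    rw [map_smul, LinearMap.comp_apply, ← map_smul, redMk_smul]
  refine ⟨ObjectProperty.homMk (ModuleCat.ofHom w), ?_, ?_⟩
  · refine ObjectProperty.hom_ext _ (ModuleCat.hom_ext (LinearMap.ext fun x => ?_))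
    obtain ⟨x, rfl⟩ := X.cokerMk_surjective x
    change w (redMk ω X.P (X.fSigma x)) = redMk ω Y.P (Y.fSigma (ψ.zero x))
    rw [hw, LinearMap.comp_apply, fSigma_comm]
  · refine ObjectProperty.hom_ext _ (ModuleCat.hom_ext (LinearMap.ext fun x => ?_))
    obtain ⟨x, rfl⟩ := redMk_surjective x
    change ((susp hω).obj Y).cokerMk (ψ.one x) = ((susp hω).obj Y).redToCoker (w (redMk ω X.P x))
    rw [hw]
    rfl

/-- The projection of `Q' ⊕ P` onto the cokernel of the mapping cone. -/
noncomputable def coneMk (hω : ω ∈ nonZeroDivisors S) {X Y : MonProj S ω} (ψ : X ⟶ Y) :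
    (Y.Q × X.P) →ₗ[S] (cone hω ψ).Coker :=
  (cone hω ψ).cokerMk

lemma coneMk_surjective (hω : ω ∈ nonZeroDivisors S) {X Y : MonProj S ω} (ψ : X ⟶ Y) :
    Function.Surjective (coneMk hω ψ) :=
  (cone hω ψ).cokerMk_surjective

lemma coneMk_eq_zero (hω : ω ∈ nonZeroDivisors S) {X Y : MonProj S ω} (ψ : X ⟶ Y)
    (y : Y.Q) (x : X.P) :
    coneMk hω ψ (y, x) = 0 ↔ ∃ p q, Y.f p + ψ.zero q = y ∧ -X.fSigma q = x := by
  refine (cone hω ψ).cokerMk_eq_zero.trans ⟨?_, ?_⟩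
  · rintro ⟨⟨p, q⟩, h⟩
    exact ⟨p, q, congrArg Prod.fst h, congrArg Prod.snd h⟩
  · rintro ⟨p, q, h, h'⟩
    exact ⟨(p, q), Prod.ext h h'⟩

/-- The map from `P/ωP` to the cokernel of the mapping cone. -/
noncomputable def redToCone (hω : ω ∈ nonZeroDivisors S) {X Y : MonProj S ω} (ψ : X ⟶ Y) :
    Red ω X.P →ₗ[S ⧸ Ideal.span {ω}] (cone hω ψ).Coker :=
  toQuotLinear (Submodule.liftQ _ (coneMk hω ψ ∘ₗ LinearMap.inr S Y.Q X.P) (by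
    intro x hx
    obtain ⟨y, rfl⟩ := redMk_eq_zero.1 ((Submodule.Quotient.mk_eq_zero _).2 hx)
    rw [LinearMap.mem_ker, LinearMap.comp_apply, LinearMap.inr_apply, coneMk_eq_zero]
    -- `(0, ω y) = c (ψ₁ y, -f y)`, by `f' ψ₁ = ψ₀ f` and `f_Σ f = ω`.
    exact ⟨ψ.one y, -X.f y, by simp [ψ.comm], by simp⟩))

lemma redToCone_mk (hω : ω ∈ nonZeroDivisors S) {X Y : MonProj S ω} (ψ : X ⟶ Y) (p : X.P) :
    redToCone hω ψ (redMk ω X.P p) = coneMk hω ψ (0, p) := rfl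

lemma cokerMap_coneInl_mk (hω : ω ∈ nonZeroDivisors S) {X Y : MonProj S ω} (ψ : X ⟶ Y)
    (y : Y.Q) : cokerMap (coneInl hω ψ) (Y.cokerMk y) = coneMk hω ψ (y, 0) := rfl

/-- Identifies the sum of the two legs, on representatives, with the projection `Q' ⊕ P → Coker c`,
which reduces the pushout criterion to the description of the image of `c`. -/
lemma cokerMap_coneInl_add_redToCone (hω : ω ∈ nonZeroDivisors S) {X Y : MonProj S ω}
    (ψ : X ⟶ Y) (y : Y.Q) (x : X.P) :
    cokerMap (coneInl hω ψ) (Y.cokerMk y) + redToCone hω ψ (redMk ω X.P x) =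
      coneMk hω ψ (y, x) := by
  rw [redToCone_mk, cokerMap_coneInl_mk, ← map_add, Prod.mk_add_mk, add_zero, zero_add]

/-- The cokernel of the mapping cone of `ψ` is the pushout of the map of cokernels induced by `ψ`
along `Coker f → P/ωP`. -/
lemma isPushout_cone (hω : ω ∈ nonZeroDivisors S) {X Y : MonProj S ω} (ψ : X ⟶ Y) :
    IsPushout (ModuleCat.ofHom (cokerMap ψ)) (ModuleCat.ofHom X.cokerToRed)
      (ModuleCat.ofHom (cokerMap (coneInl hω ψ))) (ModuleCat.ofHom (redToCone hω ψ)) := by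
  refine ModuleCat.isPushout_of_exact ?_ ?_ ?_
  · refine ModuleCat.hom_ext (LinearMap.ext fun x => ?_)
    obtain ⟨x, rfl⟩ := X.cokerMk_surjective x
    change cokerMap (coneInl hω ψ) (Y.cokerMk (ψ.zero x)) =
      redToCone hω ψ (redMk ω X.P (X.fSigma x))
    rw [← sub_eq_zero, sub_eq_add_neg, ← map_neg, ← map_neg, cokerMap_coneInl_add_redToCone,
      coneMk_eq_zero]
    -- The difference of the two composites is represented by `(ψ₀ x, -f_Σ x) = c (0, x)`, the
    -- second column of `c`.
    exact ⟨0, x, by simp, rfl⟩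
  · intro z
    obtain ⟨⟨y, x⟩, rfl⟩ := coneMk_surjective hω ψ z
    exact ⟨Y.cokerMk y, redMk ω X.P x, cokerMap_coneInl_add_redToCone hω ψ y x⟩
  · intro y x h
    obtain ⟨y, rfl⟩ := Y.cokerMk_surjective y
    obtain ⟨x, rfl⟩ := redMk_surjective x
    -- A relation in `Coker c` is `(f' p + ψ₀ q, -f_Σ q)`. The term `f' p` dies in `Coker f'`, so
    -- the class of `q` is the required element of `Coker f`.
    obtain ⟨p, q, rfl, rfl⟩ := (coneMk_eq_zero hω ψ y x).1
      ((cokerMap_coneInl_add_redToCone hω ψ y x).symm.trans h)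
    refine ⟨X.cokerMk q, ?_, ?_⟩
    · change Y.cokerMk (ψ.zero q) = _
      rw [map_add, Y.cokerMk_eq_zero.2 ⟨p, rfl⟩, zero_add]
    · change redMk ω X.P (X.fSigma q) = _
      rw [map_neg, neg_neg]

end Cosyzygy

end MonProj

/-! ### Modules of projective dimension at most one -/

lemma gorensteinProjective.of_linearEquiv {R : Type u} [CommRing R] {M N : ModuleCat.{u} R}
    (hM : gorensteinProjective R M) (e : M ≃ₗ[R] N) : gorensteinProjective R N := by
  obtain ⟨h, K, n, ⟨e'⟩⟩ := hM
  exact ⟨Module.Finite.equiv e, K, n, ⟨e.symm.trans e'⟩⟩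

/-- An object whose identity is a sum of two morphisms factoring through `Y` and `Z` is a retract
of `Y ⊞ Z`. -/
lemma CategoryTheory.hasProjectiveDimensionLT_of_id_eq_add {𝒜 : Type*} [Category* 𝒜] [Abelian 𝒜]
    {X Y Z : 𝒜} {a : X ⟶ Y} {b : Y ⟶ X} {c : X ⟶ Z} {d : Z ⟶ X} (h : a ≫ b + c ≫ d = 𝟙 X)
    (n : ℕ) [HasProjectiveDimensionLT Y n] [HasProjectiveDimensionLT Z n] :
    HasProjectiveDimensionLT X n :=
  Retract.hasProjectiveDimensionLT (Y := Y ⊞ Z)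
    { i := Limits.biprod.lift a c
      r := Limits.biprod.desc b d
      retract := by rw [Limits.biprod.lift_desc, h] } n

lemma ModuleCat.shortExact_of_exact {A : Type u} [CommRing A] {M N L : ModuleCat.{u} A}
    (f : M ⟶ N) (g : N ⟶ L) (hf : Function.Injective f) (hfg : Function.Exact f g)
    (hg : Function.Surjective g) :
    (ShortComplex.mk f g (ModuleCat.hom_ext (LinearMap.ext hfg.apply_apply_eq_zero))).ShortExact :=
  .mk' ((ShortComplex.ShortExact.moduleCat_exact_iff_function_exact _).2 hfg)
    ((ModuleCat.mono_iff_injective _).2 hf) ((ModuleCat.epi_iff_surjective _).2 hg)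

section ProjectiveDimension

variable {S : Type u} [CommRing S] {ω : S}

lemma smul_eq_zero_of_quot {N : Type*} [AddCommGroup N] [Module S N]
    [Module (S ⧸ Ideal.span {ω}) N] [IsScalarTower S (S ⧸ Ideal.span {ω}) N] (x : N) :
    ω • x = 0 := by
  rw [← algebraMap_smul (S ⧸ Ideal.span {ω}) ω x]
  have : algebraMap S (S ⧸ Ideal.span {ω}) ω = 0 :=
    Ideal.Quotient.eq_zero_iff_mem.2 (Ideal.mem_span_singleton_self ω)
  rw [this, zero_smul]

/-- The map `f` is itself a projective resolution of length one; the strict bound `2` expresses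
projective dimension at most one. -/
lemma MonProj.hasProjectiveDimensionLT_coker (X : MonProj S ω) :
    HasProjectiveDimensionLT (ModuleCat.of S X.Coker) 2 := by
  have hP : Projective X.P := X.P.projective_of_categoryTheory_projective
  have hQ : Projective X.Q := X.Q.projective_of_categoryTheory_projective
  exact (ModuleCat.shortExact_of_exact (ModuleCat.ofHom X.f) (ModuleCat.ofHom X.cokerMk)
    X.injective (fun x => X.cokerMk_eq_zero) X.cokerMk_surjective).hasProjectiveDimensionLT_X₃ 1
      inferInstance inferInstance

/-- A finitely generated `S/(ω)`-module whose projective dimension over `S` is at most one is the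
cokernel of an object of `Mon(ω, 𝒫)`. -/
lemma MonProj.exists_coker_equiv [IsNoetherianRing S] (N : Type u) [AddCommGroup N] [Module S N]
    [Module (S ⧸ Ideal.span {ω}) N] [IsScalarTower S (S ⧸ Ideal.span {ω}) N]
    [Module.Finite (S ⧸ Ideal.span {ω}) N]
    (h : HasProjectiveDimensionLT (ModuleCat.of S N) 2) :
    ∃ X : MonProj S ω, Nonempty (X.Coker ≃ₗ[S ⧸ Ideal.span {ω}] N) := by
  have : Module.Finite S N := Module.Finite.trans (S ⧸ Ideal.span {ω}) N
  obtain ⟨n, q, hq⟩ := Module.Finite.exists_fin' S N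
  -- In projective dimension at most one the first syzygy is projective, so the inclusion of `ker q`
  -- in `Sⁿ` is the desired object. Its cokernel is killed by `ω` because `N` is, and `ker q` is
  -- finitely generated because `S` is noetherian.
  have hproj : HasProjectiveDimensionLT (ModuleCat.of S (LinearMap.ker q)) 1 :=
    (ModuleCat.shortExact_of_exact (L := ModuleCat.of S N)
      (ModuleCat.ofHom (LinearMap.ker q).subtype) (ModuleCat.ofHom q)
      Subtype.val_injective (LinearMap.exact_subtype_ker_map q) hq).hasProjectiveDimensionLT_X₁ 1
      (inferInstanceAs (HasProjectiveDimensionLT (ModuleCat.of S (Fin n → S)) 1)) h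
  have : Module.Projective S (LinearMap.ker q) :=
    (IsProjective.iff_projective _).2 (projective_iff_hasProjectiveDimensionLT_one.2 hproj)
  obtain ⟨X, ⟨e⟩⟩ : ∃ X : MonProj S ω, Nonempty (X.Coker ≃ₗ[S] N) := by
    refine ⟨{
      P := ModuleCat.of S (LinearMap.ker q)
      Q := ModuleCat.of S (Fin n → S)
      f := (LinearMap.ker q).subtype
      finite_P := inferInstanceAs (Module.Finite S (LinearMap.ker q))
      finite_Q := inferInstanceAs (Module.Finite S (Fin n → S))
      projective_P := inferInstanceAs (Module.Projective S (LinearMap.ker q))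
      projective_Q := inferInstanceAs (Module.Projective S (Fin n → S))
      injective := Subtype.val_injective
      torsion := isTorsionBy_of_smul_mem fun x => ⟨⟨ω • x, by
        rw [LinearMap.mem_ker, map_smul, smul_eq_zero_of_quot]⟩, rfl⟩ },
      ⟨(Submodule.quotEquivOfEq _ (LinearMap.ker q) (Submodule.range_subtype _)).trans
        (q.quotKerEquivOfSurjective hq)⟩⟩
  exact ⟨X, ⟨LinearEquiv.ofBijective (toQuotLinear e.toLinearMap) e.bijective⟩⟩

/-- Restriction of scalars from `S/(ω)` to `S`. -/
noncomputable abbrev resQuot (ω : S) : ModuleCat.{u} (S ⧸ Ideal.span {ω}) ⥤ ModuleCat.{u} S :=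
  ModuleCat.restrictScalars (algebraMap S (S ⧸ Ideal.span {ω}))

lemma MonProj.hasProjectiveDimensionLT_resQuot_coker (X : MonProj S ω) :
    HasProjectiveDimensionLT
      ((resQuot ω).obj (ModuleCat.of (S ⧸ Ideal.span {ω}) X.Coker)) 2 := by
  have := X.hasProjectiveDimensionLT_coker
  refine hasProjectiveDimensionLT_of_iso (X := ModuleCat.of S X.Coker)
    (LinearEquiv.toModuleIso (X₂ := (resQuot ω).obj (ModuleCat.of (S ⧸ Ideal.span {ω}) X.Coker))
      { AddEquiv.refl X.Coker with
        map_smul' := fun s x => (algebraMap_smul (S ⧸ Ideal.span {ω}) s x).symm }) 2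

/-- Such a module is the cokernel of an object of `Mon(ω, 𝒫)`, hence a syzygy of a 2-periodic
complex. The criterion is useful because a bound on projective dimension over `S` passes to
retracts. -/
lemma gorensteinProjective_of_hasProjectiveDimensionLT [IsNoetherianRing S]
    (hω : ω ∈ nonZeroDivisors S) (N : ModuleCat.{u} (S ⧸ Ideal.span {ω}))
    [Module.Finite (S ⧸ Ideal.span {ω}) N]
    (h : HasProjectiveDimensionLT ((resQuot ω).obj N) 2) :
    gorensteinProjective (S ⧸ Ideal.span {ω}) N := by
  let _ : Module S N := Module.compHom N (algebraMap S (S ⧸ Ideal.span {ω}))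
  have : IsScalarTower S (S ⧸ Ideal.span {ω}) N := ⟨fun s r _ => by
    rw [Algebra.smul_def, mul_smul]
    rfl⟩
  obtain ⟨X, ⟨e⟩⟩ := MonProj.exists_coker_equiv (ω := ω) N h
  exact (X.gorensteinProjective_coker hω).of_linearEquiv e

/-- The object `ω : Sⁿ → Sⁿ` of `Mon(ω, 𝒫)`, with cokernel `(S/(ω))ⁿ`. -/
noncomputable def MonProj.ofSMul (hω : ω ∈ nonZeroDivisors S) (n : ℕ) : MonProj S ω where
  P := ModuleCat.of S (Fin n → S)
  Q := ModuleCat.of S (Fin n → S)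
  f := ω • LinearMap.id
  finite_P := inferInstanceAs (Module.Finite S (Fin n → S))
  finite_Q := inferInstanceAs (Module.Finite S (Fin n → S))
  projective_P := inferInstanceAs (Module.Projective S (Fin n → S))
  projective_Q := inferInstanceAs (Module.Projective S (Fin n → S))
  injective := (injective_iff_map_eq_zero _).2 fun _ hx =>
    eq_zero_of_smul_eq_zero (M := Fin n → S) hω hx
  torsion := isTorsionBy_of_smul_mem (LinearMap.mem_range_self _)

/-- Over `R`, the module is a direct summand of `Rⁿ`, the cokernel of `ω : Sⁿ → Sⁿ`. -/
lemma hasProjectiveDimensionLT_resQuot_of_projective (hω : ω ∈ nonZeroDivisors S)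
    (I : ModuleCat.{u} (S ⧸ Ideal.span {ω})) [Module.Finite (S ⧸ Ideal.span {ω}) I]
    [Module.Projective (S ⧸ Ideal.span {ω}) I] :
    HasProjectiveDimensionLT ((resQuot ω).obj I) 2 := by
  let _ : Module S I := Module.compHom I (algebraMap S (S ⧸ Ideal.span {ω}))
  have : IsScalarTower S (S ⧸ Ideal.span {ω}) I := ⟨fun s r _ => by
    rw [Algebra.smul_def, mul_smul]
    rfl⟩
  have : Module.Finite S I := Module.Finite.trans (S ⧸ Ideal.span {ω}) I
  obtain ⟨n, q, hq⟩ := Module.Finite.exists_fin' S I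
  let X := MonProj.ofSMul hω n
  let r : X.Coker →ₗ[S ⧸ Ideal.span {ω}] I := toQuotLinear ((LinearMap.range X.f).liftQ q (by
    rintro _ ⟨x, rfl⟩
    exact (q.map_smul ω x).trans (smul_eq_zero_of_quot _)))
  have hr : Function.Surjective r := fun x => by
    obtain ⟨y, rfl⟩ := hq x
    exact ⟨X.cokerMk y, rfl⟩
  obtain ⟨s, hs⟩ := Module.projective_lifting_property r LinearMap.id hr
  have := X.hasProjectiveDimensionLT_resQuot_coker
  let ρ : Retract I (ModuleCat.of (S ⧸ Ideal.span {ω}) X.Coker) :=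
    { i := ModuleCat.ofHom s
      r := ModuleCat.ofHom r
      retract := ModuleCat.hom_ext hs }
  exact (ρ.map (resQuot ω)).hasProjectiveDimensionLT 2

end ProjectiveDimension

/-! ### The cokernel functor is a triangle functor -/

section

variable {S : Type u} [CommRing S] {ω : S}

/-- The pushout of a morphism of cokernels along the chosen cosyzygy exists in `Gp(R)`. -/
lemma MonProj.exists_standard_pushout [IsNoetherianRing S] (hω : ω ∈ nonZeroDivisors S)
    {X Y : MonProj S ω} (ψ : X ⟶ Y) :
    ∃ (C : Gp (S ⧸ Ideal.span {ω})) (v : (cokerFunctor hω).obj Y ⟶ C)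
      (j : ((cokerFunctor hω).obj X).cosyzygy.I ⟶ C)
      (w : C ⟶ ((cokerFunctor hω).obj X).cosyzygy.N),
      IsPushout ((cokerFunctor hω).map ψ) ((cokerFunctor hω).obj X).cosyzygy.i v j ∧
        v ≫ w = 0 ∧ j ≫ w = ((cokerFunctor hω).obj X).cosyzygy.p := by
  let d := ((cokerFunctor hω).obj X).cosyzygy
  obtain ⟨k, s, hk⟩ := (X.cosyzygy hω).exists_induced d (𝟙 _)
  obtain ⟨l, r, hl⟩ := d.exists_induced (X.cosyzygy hω) (𝟙 _)
  obtain ⟨τ, hτ, -⟩ := Gp.Cosyzygy.Induced.exists_homotopy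
    (by simpa using hl.comp hk : d.Induced d (𝟙 _) (l ≫ k) (r ≫ s)) (.id d)
  -- The pushout is first formed among all modules; that it lies in `Gp(R)` is the point to be
  -- proved. It is compared with `C'`, the cokernel of the cone, of which only finiteness and the
  -- bound over `S` are kept.
  obtain ⟨C, v, j, H⟩ : ∃ (C : ModuleCat.{u} (S ⧸ Ideal.span {ω}))
      (v : ((cokerFunctor hω).obj Y).obj ⟶ C) (j : d.I.obj ⟶ C),
      IsPushout ((cokerFunctor hω).map ψ).hom d.i.hom v j :=
    ⟨_, _, _, .of_hasPushout _ _⟩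
  obtain ⟨C', v', j', H', hpd⟩ : ∃ (C' : Gp (S ⧸ Ideal.span {ω}))
      (v' : ((cokerFunctor hω).obj Y).obj ⟶ C'.obj) (j' : (X.cosyzygy hω).I.obj ⟶ C'.obj),
      IsPushout ((cokerFunctor hω).map ψ).hom (X.cosyzygy hω).i.hom v' j' ∧
        HasProjectiveDimensionLT ((resQuot ω).obj C'.obj) 2 :=
    ⟨(cokerFunctor hω).obj (cone hω ψ), _, _, isPushout_cone hω ψ,
      (cone hω ψ).hasProjectiveDimensionLT_resQuot_coker⟩
  have hki : (X.cosyzygy hω).i.hom ≫ k.hom = d.i.hom :=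
    congrArg (fun f => f.hom) (hk.i_comp.trans (Category.id_comp _))
  have hli : d.i.hom ≫ l.hom = (X.cosyzygy hω).i.hom :=
    congrArg (fun f => f.hom) (hl.i_comp.trans (Category.id_comp _))
  have hlk : l.hom ≫ k.hom - 𝟙 d.I.obj = d.p.hom ≫ τ.hom := congrArg (fun f => f.hom) hτ
  obtain ⟨w, hvw, hjw⟩ := H.exists_desc (0 : ((cokerFunctor hω).obj Y).obj ⟶ d.N.obj) d.p.hom
    (by rw [Limits.comp_zero]; exact (congrArg (fun f => f.hom) d.comp_zero).symm)
  obtain ⟨g, hvg, hjg⟩ := H'.exists_desc v (k.hom ≫ j) (by rw [reassoc_of% hki, H.w])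
  obtain ⟨g', hvg', hjg'⟩ := H.exists_desc v' (l.hom ≫ j') (by rw [reassoc_of% hli, H'.w])
  have key := H.comparison hvg' hjg' hvg hjg hlk hvw hjw
  -- The identity of `C` is a sum of maps through `C'` and `d.I`. This makes `[g j]` surjective, so
  -- `C` is finitely generated, and makes `C` a retract of `C' ⊕ d.I`, so the bound over `S` passes
  -- to `C`.
  have key' : g' ≫ g + (-w) ≫ τ.hom ≫ j = 𝟙 _ := by
    rw [Preadditive.neg_comp, ← key]
    abel
  have := d.projective
  have hfin' : Module.Finite (S ⧸ Ideal.span {ω}) C'.obj := C'.property.1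
  have hI : Module.Finite (S ⧸ Ideal.span {ω}) d.I.obj := d.I.property.1
  have hfin : Module.Finite (S ⧸ Ideal.span {ω}) C :=
    Module.Finite.of_surjective (g.hom.coprod j.hom) fun x =>
      ⟨(g' x, τ.hom (-(w x))), congrArg (fun f => f.hom x) key'⟩
  have hpd' := hasProjectiveDimensionLT_resQuot_of_projective hω d.I.obj
  have hC := gorensteinProjective_of_hasProjectiveDimensionLT hω C
    (hasProjectiveDimensionLT_of_id_eq_add
      (a := (resQuot ω).map g') (b := (resQuot ω).map g)
      (c := (resQuot ω).map ((-w) ≫ τ.hom)) (d := (resQuot ω).map j) (by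
        rw [← Functor.map_comp, ← Functor.map_comp, ← Functor.map_add, Category.assoc, key',
          CategoryTheory.Functor.map_id]) 2)
  refine ⟨⟨_, hC⟩, ObjectProperty.homMk v, ObjectProperty.homMk j, ObjectProperty.homMk w,
    ?_, ObjectProperty.hom_ext _ hvw, ObjectProperty.hom_ext _ hjw⟩
  -- A pushout of modules whose corners all lie in the full subcategory is a pushout there.
  exact IsPushout.of_map (gorensteinProjective _).ι (ObjectProperty.hom_ext _ H.w) H

/-- The natural isomorphism `TΣ ≅ Ω⁻¹T`. -/
noncomputable def HMon.suspIso (hω : ω ∈ nonZeroDivisors S) :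
    HMon.susp hω ⋙ HMon.T hω ≅ HMon.T hω ⋙ StableGp.susp (S ⧸ Ideal.span {ω}) :=
  NatIso.ofComponents (fun X => (X.as.cosyzygy hω).stableIso _) (by
    intro X Y f
    obtain ⟨f, rfl⟩ := (CategoryTheory.Quotient.functor _).map_surjective f
    obtain ⟨w, hw⟩ := MonProj.cosyzygy_induced hω f
    exact hw.stableIso_naturality)

instance HMon.T_additive (hω : ω ∈ nonZeroDivisors S) : (HMon.T hω).Additive where
  map_add {X Y} f g := by
    obtain ⟨f, rfl⟩ := (CategoryTheory.Quotient.functor _).map_surjective f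
    obtain ⟨g, rfl⟩ := (CategoryTheory.Quotient.functor _).map_surjective g
    have h : (MonProj.cokerFunctor hω).map (f + g) =
        (MonProj.cokerFunctor hω).map f + (MonProj.cokerFunctor hω).map g := by
      refine ObjectProperty.hom_ext _ (ModuleCat.hom_ext (LinearMap.ext fun x => ?_))
      obtain ⟨x, rfl⟩ := MonProj.cokerMk_surjective _ x
      rfl
    exact congrArg (CategoryTheory.Quotient.functor (Gp.stablyEqual _)).map h

/-- The image of a standard triangle is exact. -/
lemma HMon.map_standardTriangle_exact [IsNoetherianRing S] (hω : ω ∈ nonZeroDivisors S)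
    {X Y : MonProj S ω} (ψ : X ⟶ Y) :
    (HMon.standardTriangle hω ψ).map (HMon.T hω) (HMon.suspIso hω) ∈
      (StableGp.triangleData (S ⧸ Ideal.span {ω})).exact := by
  obtain ⟨C, v, j, w, H, hvw, hjw⟩ := MonProj.exists_standard_pushout hω ψ
  refine ⟨_, _, C, (MonProj.cokerFunctor hω).map ψ, v, j, w, H, hvw, hjw, ?_⟩
  have H' : IsPushout ((MonProj.cokerFunctor hω).map ψ) (X.cosyzygy hω).i
      ((MonProj.cokerFunctor hω).map (MonProj.coneInl hω ψ))
      (ObjectProperty.homMk (ModuleCat.ofHom (MonProj.redToCone hω ψ))) :=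
    IsPushout.of_map (gorensteinProjective _).ι
      (ObjectProperty.hom_ext _ (MonProj.isPushout_cone hω ψ).w) (MonProj.isPushout_cone hω ψ)
  -- The map on cokernels induced by `[0 id]` kills `Coker f'` and restricts to the projection `P/ωP
  -- → Coker(-f_Σ)`, so it is the third map for the explicit cosyzygy; `ζ` then supplies the passage
  -- to the chosen one.
  refine Gp.Cosyzygy.isomorphic_mkTriangle (c := X.cosyzygy hω) H'
    (w' := (MonProj.cokerFunctor hω).map (MonProj.coneSnd hω ψ)) ?_ ?_ H hvw hjw _ rfl
  · refine ObjectProperty.hom_ext _ (ModuleCat.hom_ext (LinearMap.ext fun x => ?_))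
    obtain ⟨x, rfl⟩ := Y.cokerMk_surjective x
    exact map_zero ((MonProj.susp hω).obj X).cokerMk
  · refine ObjectProperty.hom_ext _ (ModuleCat.hom_ext (LinearMap.ext fun x => ?_))
    obtain ⟨x, rfl⟩ := redMk_surjective x
    rfl

end

theorem mainTheorem7 (S : Type u) [CommRing S] [IsNoetherianRing S] [IsLocalRing S] (ω : S)
    (hmem : ω ∈ IsLocalRing.maximalIdeal S) (hω : ω ∈ nonZeroDivisors S) :
    IsTriangleFunctor (HMon.triangleData hω) (StableGp.triangleData (S ⧸ Ideal.span {ω}))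
      (HMon.T hω) := by
  refine ⟨inferInstance, HMon.suspIso hω, ?_⟩
  rintro t ⟨X, Y, ψ, ht⟩
  obtain ⟨M, M', C, u, v, j, w, H, hvw, hjw, h⟩ := HMon.map_standardTriangle_exact hω ψ
  exact ⟨M, M', C, u, v, j, w, H, hvw, hjw, (ht.map _ _).trans h⟩
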